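/- Define the generalized two-dimensional Sierpinski gasket $SG_{2,4}(n)$ of side length $4$ as follows: $SG_{2,4}(0)$ is a triangle (three mutually adjacent vertices drawn as an equilateral triangle of side $1$), and $SG_{2,4}(n+1)$ is the union of the ten translates of $SG_{2,4}(n)$ that are arranged, all in the same orientation, in four layers inside an equilateral triangle of side $4^{n+1}$, neighbouring copies sharing exactly one outmost vertex. (In the triangular lattice with basis $e_1=(1,0)$, $e_2=(\tfrac12,\tfrac{\sqrt3}{2})$ these are the translates by $4^n(i e_1+j e_2)$ with integers $i,j\ge 0$, $i+j\le 3$.) For a finite graph $G$ let $v(G)$ be its number of vertices and let $N_{DM}(G)$ be the number of dimer-monomers on $G$, i.e. the number of all (not necessarily perfect, possibly empty) matchings of $G$. Proposition. The numbers of vertices $v(SG_{2,4}(n))$ tend to infinity as $n\to\infty$, the limit $$z_{SG_{2,4}}=\lim_{n\to\infty}\frac{\ln N_{DM}(SG_{2,4}(n))}{v(SG_{2,4}(n))}$$ exists, and its decimal expansion begins $z_{SG_{2,4}}=0.684872262332\ldots$, that is, $$0.684872262332\le z_{SG_{2,4}}<0.684872262333 .$$ -/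

import Mathlib

open Filter Topology

noncomputable section

namespace SierpinskiGasket

/-- The pair `(x, y)` stands for the point `x • e₁ + y • e₂` of the triangular lattice, where
`e₁ = (1, 0)` and `e₂ = (1/2, √3/2)`. This is the translation by the lattice vector `c`. -/
def latticeShift (c : ℕ × ℕ) : (⊤ : SimpleGraph (ℕ × ℕ)) →g (⊤ : SimpleGraph (ℕ × ℕ)) where
  toFun p := c + p
  map_rel' := by
    intro p q h
    simpa using h

/-- The generalized two-dimensional Sierpinski gasket of side length `b` at stage `n`,
as a finite graph drawn on the triangular lattice (in the triangle of side length `b ^ n`).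
Stage `0` is a triangle. Stage `n + 1` is the union of the `b * (b + 1) / 2` translates of stage `n`
by `b ^ n • (i, j)`, `i + j < b`, i.e. `b` layers of copies of stage `n`, where neighbouring copies
share exactly one outmost vertex. -/
def gasket (b : ℕ) : ℕ → (⊤ : SimpleGraph (ℕ × ℕ)).Subgraph
  | 0 => (⊤ : (⊤ : SimpleGraph (ℕ × ℕ)).Subgraph).induce {(0, 0), (1, 0), (0, 1)}
  | n + 1 => ⨆ c : {c : ℕ × ℕ // c.1 + c.2 < b}, (gasket b n).map (latticeShift (b ^ n • c.1))

/-- The gasket as a graph on its own vertex set. -/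
abbrev SG (b n : ℕ) : SimpleGraph (gasket b n).verts := (gasket b n).coe

/-- The number of dimer-monomers on a graph: the number of (not necessarily perfect, possibly empty)
matchings. The edges of the matching are the dimers, the uncovered vertices are the monomers.
A matching is a subgraph whose vertices are exactly the covered ones. -/
def dimerMonomerCount {V : Type*} (G : SimpleGraph V) : ℕ :=
  Nat.card {M : G.Subgraph // M.IsMatching}

/-- `z` is the asymptotic growth constant of the number of dimer-monomers along the sequence `G`
of graphs: the numbers of vertices tend to infinity and `log (N_DM G) / v(G)` tends to `z`. -/
def IsGrowthConstant {V : ℕ → Type*} (G : ∀ n, SimpleGraph (V n)) (z : ℝ) : Prop :=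
  Tendsto (fun n => Nat.card (V n)) atTop atTop ∧
    Tendsto (fun n => Real.log (dimerMonomerCount (G n)) / (Nat.card (V n) : ℝ)) atTop (𝓝 z)

end SierpinskiGasket

end

/-! Ten copies of stage `n` are glued at fifteen nodes: three outer corners, each in one copy, nine
nodes in two copies and three inner nodes in three copies. A matching of the union is a family of
matchings of the copies in which each node is covered by at most one of its copies. Hence the
numbers of matchings with prescribed coverage of the three corners satisfy a closed recursion
`step`, a polynomial with nonnegative coefficients (`count_succ`). The same gluing gives `3 v(n) = 4
* 10 ^ n + 5`.

The growth is controlled by the ratios of the count with a corner covered to the count with it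
uncovered. An outer corner lies in one copy only, so `step` is linear in the weights of that copy. A
bound `l ≤ ratio ≤ u` therefore passes from one stage to the next (`RatioBounds.step`). If all
ratios equalled `l`, the weight would be a product over corners and the recursion would read `f' = f
^ 10 * (1 + 2 * l) ^ 9 * (1 + 3 * l) ^ 3` (`step_geomWeight`). By monotonicity the true value lies
between this expression at `l` and at `u`, so `log f` is multiplied by 10 up to a bounded error.
This gives the limit and explicit bounds for it from any stage at which the ratios are bounded
(`exists_tendsto_div_pow`).

At stage 2, computed exactly, all ratios lie in a window of width `2.8 * 10 ^ (-12)`. The resulting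
uncertainty in `z` is about `2 * 10 ^ (-14)`, and the decimals follow by comparing rational numbers.
-/

namespace SierpinskiGasket

/-! ### Matchings as independent edge sets, and gluing along junctions -/

section Matchings

/-- A vertex is covered by a set of edges if it is an end of one of them. -/
def Covers {V : Type*} (M : Finset (Sym2 V)) (v : V) : Prop := ∃ e ∈ M, v ∈ e

instance {V : Type*} [DecidableEq V] (M : Finset (Sym2 V)) (v : V) : Decidable (Covers M v) :=
  inferInstanceAs (Decidable (∃ e ∈ M, v ∈ e))

/-- A set of edges is independent if no two of its edges share a vertex. -/
def Independent {V : Type*} (M : Finset (Sym2 V)) : Prop :=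
  ∀ e ∈ M, ∀ e' ∈ M, ∀ v, v ∈ e → v ∈ e' → e = e'

instance {V : Type*} [DecidableEq V] (M : Finset (Sym2 V)) : Decidable (Independent M) :=
  decidable_of_iff (∀ e ∈ M, ∀ e' ∈ M, ∀ v ∈ e.toFinset, v ∈ e'.toFinset → e = e') <| by
    simp [Independent]

/-- The matchings contained in a finite set of edges. -/
def matchings {V : Type*} [DecidableEq V] (E : Finset (Sym2 V)) : Finset (Finset (Sym2 V)) :=
  {M ∈ E.powerset | Independent M}

theorem mem_matchings {V : Type*} [DecidableEq V] {E M : Finset (Sym2 V)} :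
    M ∈ matchings E ↔ M ⊆ E ∧ Independent M := by
  simp [matchings]

theorem Independent.mono {V : Type*} {M N : Finset (Sym2 V)} (h : Independent N) (hMN : M ⊆ N) :
    Independent M :=
  fun e he e' he' => h e (hMN he) e' (hMN he')

theorem Covers.mono {V : Type*} {M N : Finset (Sym2 V)} {v : V} (h : Covers M v) (hMN : M ⊆ N) :
    Covers N v := by
  obtain ⟨e, he, hv⟩ := h
  exact ⟨e, hMN he, hv⟩

/-- The number of matchings of a finite graph is the number of independent subsets of its
edge set. -/
theorem dimerMonomerCount_coe {V : Type*} [DecidableEq V] {G : SimpleGraph V} (H : G.Subgraph)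
    (E : Finset (Sym2 V)) (hE : ∀ a b, H.Adj a b ↔ s(a, b) ∈ E) :
    dimerMonomerCount H.coe = (matchings E).card := by
  classical
  unfold dimerMonomerCount
  rw [← Nat.card_eq_finsetCard]
  have hfin : ∀ M : H.coe.Subgraph, {e : Sym2 V | ∃ a b, M.Adj a b ∧ e = s(↑a, ↑b)} ⊆ ↑E := by
    rintro M e ⟨a, b, hab, rfl⟩
    exact (hE _ _).1 (M.adj_sub hab)
  let f : H.coe.Subgraph → Finset (Sym2 V) := fun M =>
    (E.finite_toSet.subset (hfin M)).toFinset
  have hf : ∀ (M : H.coe.Subgraph) e, e ∈ f M ↔ ∃ a b, M.Adj a b ∧ e = s(↑a, ↑b) := by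
    intro M e
    simp [f]
  have hf' : ∀ (M : H.coe.Subgraph) (a b : H.verts), s(↑a, ↑b) ∈ f M ↔ M.Adj a b := by
    intro M a b
    rw [hf]
    constructor
    · rintro ⟨c, d, h, he⟩
      rw [Sym2.eq_iff] at he
      rcases he with ⟨h1, h2⟩ | ⟨h1, h2⟩
      · rwa [Subtype.ext h1, Subtype.ext h2]
      · rw [Subtype.ext h1, Subtype.ext h2]; exact h.symm
    · intro h
      exact ⟨a, b, h, rfl⟩
  refine Nat.card_eq_of_bijective
    (fun M => (⟨f M.1, ?_⟩ : matchings E)) ⟨?_, ?_⟩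
  · rw [mem_matchings]
    refine ⟨fun e he => hfin M.1 ((hf _ _).1 he), ?_⟩
    intro e he e' he' v hv hv'
    obtain ⟨a, b, hab, rfl⟩ := (hf _ _).1 he
    obtain ⟨c, d, hcd, rfl⟩ := (hf _ _).1 he'
    have key : ∀ a b c d : H.verts, M.1.Adj a b → M.1.Adj c d → (a : V) = c →
        s((a : V), (b : V)) = s((c : V), (d : V)) := by
      intro a b c d hab hcd hac
      obtain rfl := Subtype.ext hac
      rw [M.2.eq_of_adj_left hab hcd]
    rw [Sym2.mem_iff] at hv hv'
    rcases hv with rfl | rfl <;> rcases hv' with h | h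
    · exact key a b c d hab hcd h
    · rw [Sym2.eq_swap (a := (c : V))]; exact key a b d c hab hcd.symm h
    · rw [Sym2.eq_swap (a := (a : V))]; exact key b a c d hab.symm hcd h
    · rw [Sym2.eq_swap (a := (a : V)), Sym2.eq_swap (a := (c : V))]
      exact key b a d c hab.symm hcd.symm h
  · intro M N h
    have h1 : f M.1 = f N.1 := congrArg Subtype.val h
    have hadj : ∀ a b, M.1.Adj a b ↔ N.1.Adj a b := fun a b => by rw [← hf', ← hf', h1]
    apply Subtype.ext
    apply SimpleGraph.Subgraph.ext
    · ext v
      -- In a matching every vertex is covered, so the adjacency relation determines the vertex set.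
      rw [← M.2.support_eq_verts, ← N.2.support_eq_verts]
      simp only [SimpleGraph.Subgraph.mem_support, hadj]
    · ext a b
      exact hadj a b
  · rintro ⟨F, hF⟩
    rw [mem_matchings] at hF
    obtain ⟨hFE, hind⟩ := hF
    refine ⟨⟨{ verts := {v | ∃ w : H.verts, s((v : V), (w : V)) ∈ F}
               Adj := fun a b => s((a : V), (b : V)) ∈ F
               adj_sub := fun {a b} h => (hE _ _).2 (hFE h)
               edge_vert := fun {a b} h => ⟨b, h⟩
               symm := ⟨fun a b h => by rwa [Sym2.eq_swap]⟩ }, ?_⟩, ?_⟩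
    · rintro v ⟨w, hw⟩
      refine ⟨w, hw, fun y hy => ?_⟩
      have := hind _ hw _ hy v (by simp) (by simp)
      exact Subtype.ext (Sym2.congr_right.1 this).symm
    · apply Subtype.ext
      ext e
      rw [hf]
      constructor
      · rintro ⟨a, b, hab, rfl⟩
        exact hab
      · intro he
        induction e using Sym2.ind with
        | _ x y =>
          have := (hE _ _).2 (hFE he)
          exact ⟨⟨x, H.edge_vert this⟩, ⟨y, H.edge_vert this.symm⟩, he, rfl⟩

/-- Matchings of an edge-disjoint union of finite graphs that meet only in the junctions `j p`,
where the piece `q p` (if any) covers the junction `j p`, are families of matchings of the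
pieces. -/
theorem card_matchings_biUnion {V ι P : Type*} [DecidableEq V] [Fintype ι] [DecidableEq ι]
    [Fintype P] (E : ι → Finset (Sym2 V)) (j : P → V)
    (hdisj : ∀ c c', c ≠ c' → Disjoint (E c) (E c'))
    (hmeet : ∀ c c', c ≠ c' → ∀ e ∈ E c, ∀ e' ∈ E c', ∀ v, v ∈ e → v ∈ e' → ∃ p, j p = v)
    (q : P → Option ι) :
    Finset.card {M ∈ matchings (Finset.univ.biUnion E) |
      ∀ p c, Covers (M ∩ E c) (j p) ↔ q p = some c} =
    ∏ c, Finset.card {M ∈ matchings (E c) | ∀ p, Covers M (j p) ↔ q p = some c} := by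
  rw [← Fintype.card_piFinset]
  have hinter : ∀ (F : ι → Finset (Sym2 V)), (∀ c, F c ⊆ E c) → ∀ c,
      Finset.univ.biUnion F ∩ E c = F c := by
    intro F hF c
    ext e
    simp only [Finset.mem_inter, Finset.mem_biUnion, Finset.mem_univ, true_and]
    constructor
    · rintro ⟨⟨c', hc'⟩, he⟩
      by_cases h : c' = c
      · rwa [h] at hc'
      · exact absurd he (Finset.disjoint_left.1 (hdisj c' c h) (hF c' hc'))
    · intro h
      exact ⟨⟨c, h⟩, hF c h⟩
  refine Finset.card_bij (fun M _ c => M ∩ E c) ?_ ?_ ?_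
  · intro M hM
    rw [Finset.mem_filter, mem_matchings] at hM
    simp only [Fintype.mem_piFinset, Finset.mem_filter, mem_matchings]
    exact fun c => ⟨⟨Finset.inter_subset_right, hM.1.2.mono Finset.inter_subset_left⟩,
      fun p => hM.2 p c⟩
  · intro M hM N hN h
    rw [Finset.mem_filter, mem_matchings] at hM hN
    have aux : ∀ M ⊆ Finset.univ.biUnion E, Finset.univ.biUnion (fun c => M ∩ E c) = M := by
      intro M hM
      rw [← Finset.inter_biUnion, Finset.inter_eq_left.2 hM]
    rw [← aux M hM.1.1, ← aux N hN.1.1]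
    simp only [funext_iff] at h
    simp only [h]
  · intro F hF
    simp only [Fintype.mem_piFinset, Finset.mem_filter, mem_matchings] at hF
    have hi := hinter F fun c => (hF c).1.1
    refine ⟨Finset.univ.biUnion F, ?_, funext hi⟩
    rw [Finset.mem_filter, mem_matchings]
    refine ⟨⟨Finset.biUnion_mono fun c _ => (hF c).1.1, ?_⟩, fun p c => ?_⟩
    · intro e he e' he' v hv hv'
      simp only [Finset.mem_biUnion, Finset.mem_univ, true_and] at he he'
      obtain ⟨c, hc⟩ := he
      obtain ⟨c', hc'⟩ := he'
      by_cases h : c = c'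
      · subst h
        exact (hF c).1.2 e hc e' hc' v hv hv'
      -- Edges of different pieces can meet only at a junction; both pieces would then cover it,
      -- while `q` names at most one.
      · obtain ⟨p, rfl⟩ := hmeet c c' h e ((hF c).1.1 hc) e' ((hF c').1.1 hc') v hv hv'
        have h1 := ((hF c).2 p).1 ⟨e, hc, hv⟩
        have h2 := ((hF c').2 p).1 ⟨e', hc', hv'⟩
        exact absurd (Option.some.inj (h1.symm.trans h2)) h
    · rw [hi]
      exact (hF c).2 p

/-- The number of matchings of a union of pieces with prescribed coverage `s` of some of the
junctions, as a sum over the possible choices of the pieces that cover the junctions. -/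
theorem card_matchings_covers {V ι P S : Type*} [DecidableEq V] [Fintype ι] [DecidableEq ι]
    [Fintype P] [DecidableEq P] [Fintype S] (E : ι → Finset (Sym2 V)) (j : P → V)
    (hdisj : ∀ c c', c ≠ c' → Disjoint (E c) (E c'))
    (hmeet : ∀ c c', c ≠ c' → ∀ e ∈ E c, ∀ e' ∈ E c', ∀ v, v ∈ e → v ∈ e' → ∃ p, j p = v)
    (k : S → P) (s : S → Bool) :
    Finset.card {M ∈ matchings (Finset.univ.biUnion E) | ∀ i, Covers M (j (k i)) ↔ s i} =
    ∑ q : P → Option ι with ∀ i, q (k i) ≠ none ↔ s i,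
      ∏ c, Finset.card {M ∈ matchings (E c) | ∀ p, Covers M (j p) ↔ q p = some c} := by
  classical
  -- Every matching determines its assignment `q`: at most one edge ends at a junction, and
  -- edge-disjointness puts it in a single piece. The matchings are then partitioned according to
  -- `q`.
  have hex : ∀ M ∈ matchings (Finset.univ.biUnion E), ∃ q : P → Option ι,
      ∀ p c, Covers (M ∩ E c) (j p) ↔ q p = some c := by
    intro M hM
    rw [mem_matchings] at hM
    have : ∀ p, ∃ o : Option ι, ∀ c, Covers (M ∩ E c) (j p) ↔ o = some c := by
      intro p
      by_cases h : ∃ c, Covers (M ∩ E c) (j p)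
      · obtain ⟨c, hc⟩ := h
        refine ⟨some c, fun c' => ⟨?_, ?_⟩⟩
        · obtain ⟨e, he, hv⟩ := hc
          rintro ⟨e', he', hv'⟩
          rw [Finset.mem_inter] at he he'
          obtain rfl := hM.2 e he.1 e' he'.1 _ hv hv'
          by_contra hne
          exact Finset.disjoint_left.1 (hdisj c c' fun h => hne (by rw [h])) he.2 he'.2
        · intro h
          rwa [← Option.some.inj h]
      · exact ⟨none, fun c => ⟨fun hc => absurd ⟨c, hc⟩ h, fun hc => by simp at hc⟩⟩
    exact ⟨fun p => (this p).choose, fun p => (this p).choose_spec⟩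
  have hcov : ∀ M ∈ matchings (Finset.univ.biUnion E), ∀ q : P → Option ι,
      (∀ p c, Covers (M ∩ E c) (j p) ↔ q p = some c) → ∀ p, Covers M (j p) ↔ q p ≠ none := by
    intro M hM q hq p
    rw [mem_matchings] at hM
    rw [Option.ne_none_iff_exists']
    simp only [← hq]
    constructor
    · rintro ⟨e, he, hv⟩
      obtain ⟨c, -, hc⟩ := Finset.mem_biUnion.1 (hM.1 he)
      exact ⟨c, e, Finset.mem_inter.2 ⟨he, hc⟩, hv⟩
    · rintro ⟨c, hc⟩
      exact hc.mono Finset.inter_subset_left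
  simp only [← card_matchings_biUnion E j hdisj hmeet]
  rw [← Finset.card_biUnion]
  · congr 1
    ext M
    simp only [Finset.mem_biUnion, Finset.mem_filter, Finset.mem_univ, true_and]
    constructor
    · rintro ⟨hM, h⟩
      obtain ⟨q, hq⟩ := hex M hM
      exact ⟨q, fun i => by rw [← h, hcov M hM q hq], hM, hq⟩
    · rintro ⟨q, hs, hM, hq⟩
      exact ⟨hM, fun i => by rw [← hs, hcov M hM q hq]⟩
  · intro q _ q' _ hne
    rw [Function.onFun, Finset.disjoint_left]
    intro M hM hM'
    rw [Finset.mem_filter] at hM hM'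
    apply hne
    ext p c
    exact (hM.2 p c).symm.trans (hM'.2 p c)

end Matchings

/-! ### Cells, nodes and the number of vertices -/

section Geometry

/-- The positions of the ten copies of stage `n` in stage `n + 1`, in units of `4 ^ n`: the three
copies near each of the three corners, and the central copy. -/
def cell : Fin 10 → ℕ × ℕ :=
  ![(0, 0), (1, 0), (0, 1), (3, 0), (2, 0), (2, 1), (0, 3), (0, 2), (1, 2), (1, 1)]

/-- The fifteen corners of the ten copies: the three corners of the whole, the three midpoints
of its sides, the three inner points, and the other points on the sides. -/
def node : Fin 15 → ℕ × ℕ :=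
  ![(0, 0), (4, 0), (0, 4), (2, 0), (2, 2), (0, 2), (1, 1), (2, 1), (1, 2), (1, 0), (0, 1),
    (3, 0), (3, 1), (0, 3), (1, 3)]

/-- The corners of a unit triangle. -/
def offset : Fin 3 → ℕ × ℕ := ![(0, 0), (1, 0), (0, 1)]

/-- The nodes that are the corners of a given cell. -/
def inc : Fin 10 → Fin 3 → Fin 15 :=
  ![![0, 9, 10], ![9, 3, 6], ![10, 6, 5], ![11, 1, 12], ![3, 11, 7], ![7, 12, 4], ![13, 14, 2],
    ![5, 8, 13], ![8, 4, 14], ![6, 7, 8]]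

theorem node_inc : ∀ c i, node (inc c i) = cell c + offset i := by decide

/-- The inequalities place the node in the closed unit triangle of the cell, whose only lattice
points are its corners. -/
theorem exists_inc : ∀ c p, cell c ≤ node p →
    (node p).1 + (node p).2 ≤ (cell c).1 + (cell c).2 + 1 → ∃ i, inc c i = p := by decide

theorem exists_inc_eq : ∀ p, ∃ c i, inc c i = p := by decide

theorem cell_injective : Function.Injective cell := by
  unfold Function.Injective; decide

theorem node_injective : Function.Injective node := by
  unfold Function.Injective; decide

theorem offset_injective : Function.Injective offset := by
  unfold Function.Injective; decide

theorem exists_cell_iff (c : ℕ × ℕ) : (∃ i, cell i = c) ↔ c.1 + c.2 < 4 := by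
  constructor
  · rintro ⟨i, rfl⟩
    revert i
    decide
  · obtain ⟨a, b⟩ := c
    intro h
    simp only at h
    have ha : a < 4 := by omega
    have hb : b < 4 := by omega
    interval_cases a <;> interval_cases b <;> first | omega | decide

/-- Translation by `4 ^ n • cell c`. -/
def shift (n : ℕ) (c : Fin 10) (p : ℕ × ℕ) : ℕ × ℕ := 4 ^ n • cell c + p

theorem shift_injective (n : ℕ) (c : Fin 10) : Function.Injective (shift n c) :=
  add_right_injective _

/-- The vertices of the gasket of side length `4`. -/
def verts : ℕ → Finset (ℕ × ℕ)
  | 0 => {(0, 0), (1, 0), (0, 1)}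
  | n + 1 => Finset.univ.biUnion fun c => (verts n).image (shift n c)

/-- The edges of the gasket of side length `4`. -/
def edges : ℕ → Finset (Sym2 (ℕ × ℕ))
  | 0 => {s((0, 0), (1, 0)), s((0, 0), (0, 1)), s((1, 0), (0, 1))}
  | n + 1 => Finset.univ.biUnion fun c => (edges n).image (Sym2.map (shift n c))

theorem mem_verts_iff (n : ℕ) : ∀ p, p ∈ (gasket 4 n).verts ↔ p ∈ verts n := by
  induction n with
  | zero => intro p; simp [gasket, verts]
  | succ n ih =>
    intro p
    simp only [gasket, verts, SimpleGraph.Subgraph.verts_iSup, SimpleGraph.Subgraph.map_verts,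
      Set.mem_iUnion, Set.mem_image, Finset.mem_biUnion, Finset.mem_univ, true_and,
      Finset.mem_image, ih]
    constructor
    · rintro ⟨⟨c, hc⟩, x, hx, rfl⟩
      obtain ⟨i, rfl⟩ := (exists_cell_iff c).2 hc
      exact ⟨i, x, hx, rfl⟩
    · rintro ⟨i, x, hx, rfl⟩
      exact ⟨⟨cell i, (exists_cell_iff _).1 ⟨i, rfl⟩⟩, x, hx, rfl⟩

theorem adj_iff_mem_edges (n : ℕ) : ∀ a b, (gasket 4 n).Adj a b ↔ s(a, b) ∈ edges n := by
  induction n with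
  | zero =>
    intro a b
    simp only [gasket, edges, SimpleGraph.Subgraph.induce_adj, SimpleGraph.Subgraph.top_adj,
      SimpleGraph.top_adj, Set.mem_insert_iff, Set.mem_singleton_iff, Finset.mem_insert,
      Finset.mem_singleton, Sym2.eq_iff]
    constructor
    · rintro ⟨rfl | rfl | rfl, rfl | rfl | rfl, h⟩ <;> simp at h ⊢
    · rintro ((⟨rfl, rfl⟩ | ⟨rfl, rfl⟩) | (⟨rfl, rfl⟩ | ⟨rfl, rfl⟩) | (⟨rfl, rfl⟩ | ⟨rfl, rfl⟩)) <;>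
        simp
  | succ n ih =>
    intro a b
    simp only [gasket, edges, SimpleGraph.Subgraph.iSup_adj, SimpleGraph.Subgraph.map_adj,
      Relation.Map, Finset.mem_biUnion, Finset.mem_univ, true_and, Finset.mem_image, ih]
    constructor
    · rintro ⟨⟨c, hc⟩, x, y, hxy, rfl, rfl⟩
      obtain ⟨i, rfl⟩ := (exists_cell_iff c).2 hc
      exact ⟨i, s(x, y), hxy, rfl⟩
    · rintro ⟨i, e, he, h⟩
      induction e using Sym2.ind with
      | _ x y =>
        have hc := (exists_cell_iff _).1 ⟨i, rfl⟩
        rw [Sym2.map_mk, Sym2.eq_iff] at h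
        rcases h with ⟨rfl, rfl⟩ | ⟨rfl, rfl⟩
        · exact ⟨⟨cell i, hc⟩, x, y, he, rfl, rfl⟩
        · exact ⟨⟨cell i, hc⟩, y, x, by rwa [Sym2.eq_swap], rfl, rfl⟩

theorem mem_verts_of_mem_edges {n : ℕ} {e : Sym2 (ℕ × ℕ)} (he : e ∈ edges n) {v : ℕ × ℕ}
    (hv : v ∈ e) : v ∈ verts n := by
  induction e using Sym2.ind with
  | _ x y =>
    have h := (adj_iff_mem_edges n x y).2 he
    rcases Sym2.mem_iff.1 hv with rfl | rfl
    · exact (mem_verts_iff n _).1 ((gasket 4 n).edge_vert h)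
    · exact (mem_verts_iff n _).1 ((gasket 4 n).edge_vert h.symm)

theorem not_isDiag_of_mem_edges {n : ℕ} {e : Sym2 (ℕ × ℕ)} (he : e ∈ edges n) : ¬ e.IsDiag := by
  induction e using Sym2.ind with
  | _ x y => exact ((adj_iff_mem_edges n x y).2 he).ne

theorem cell_add_lt (c : Fin 10) : (cell c).1 + (cell c).2 < 4 := (exists_cell_iff _).1 ⟨c, rfl⟩

theorem add_le_of_mem_verts {n : ℕ} {p : ℕ × ℕ} (hp : p ∈ verts n) : p.1 + p.2 ≤ 4 ^ n := by
  induction n generalizing p with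
  | zero =>
    simp only [verts, Finset.mem_insert, Finset.mem_singleton] at hp
    rcases hp with rfl | rfl | rfl <;> simp
  | succ n ih =>
    simp only [verts, Finset.mem_biUnion, Finset.mem_univ, true_and, Finset.mem_image] at hp
    obtain ⟨c, x, hx, rfl⟩ := hp
    have h1 := ih hx
    have h2 := Nat.mul_le_mul_left (4 ^ n) (Nat.lt_succ_iff.1 (cell_add_lt c))
    simp only [shift, Prod.fst_add, Prod.snd_add, Prod.smul_fst, Prod.smul_snd, smul_eq_mul,
      pow_succ]
    linarith

/-- Two different translated triangles meet in at most one point, which is a corner of both. -/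
theorem eq_of_add_eq_add {N : ℕ} (hN : 0 < N) {a a' p p' : ℕ × ℕ} (ha : a ≠ a')
    (hp : p.1 + p.2 ≤ N) (hp' : p'.1 + p'.2 ≤ N) (h : N • a + p = N • a' + p') :
    N • a + p = N • (a ⊔ a') ∧ ∃ i, p = N • offset i := by
  obtain ⟨i, j⟩ := a
  obtain ⟨i', j'⟩ := a'
  obtain ⟨x, y⟩ := p
  obtain ⟨x', y'⟩ := p'
  simp only [Prod.smul_mk, smul_eq_mul, Prod.mk_add_mk, Prod.mk.injEq, Prod.mk_sup_mk] at h hp hp' ⊢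
  obtain ⟨h1, h2⟩ := h
  -- In one coordinate, a point at distance at most `N` from the smaller multiple can reach the
  -- larger one only if they are consecutive, and then only at the end of its range.
  have gap : ∀ {u v s t : ℕ}, N * u + s = N * v + t → s ≤ N → u < v → v = u + 1 ∧ s = N ∧ t = 0 := by
    intro u v s t h hs huv
    obtain ⟨k, rfl⟩ := Nat.exists_eq_add_of_lt huv
    have : N * (u + k + 1) = N * u + N * k + N := by ring
    have hk : N * k = 0 := by omega
    have : k = 0 := by
      rcases Nat.mul_eq_zero.1 hk with h | h
      · omega
      · exact h
    subst this
    refine ⟨by omega, by omega, by omega⟩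
  have eqv : ∀ {u v s t : ℕ}, N * u + s = N * v + t → s < N → t < N → u = v := by
    intro u v s t h hs ht
    by_contra hne
    rcases Nat.lt_or_gt_of_ne hne with hlt | hlt
    · have := gap h hs.le hlt; omega
    · have := gap h.symm ht.le hlt; omega
  rcases lt_trichotomy i i' with hi | rfl | hi
  · obtain ⟨rfl, rfl, rfl⟩ := gap h1 (by omega) hi
    obtain rfl : y = 0 := by omega
    have hj : j' ≤ j := by
      by_contra hlt
      have := gap h2 (by omega) (not_le.1 hlt)
      omega
    refine ⟨?_, 1, by simp [offset]⟩
    rw [sup_of_le_left hj, sup_of_le_right hi.le]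
    exact ⟨by ring, by ring⟩
  · rcases lt_trichotomy j j' with hj | rfl | hj
    · obtain ⟨rfl, rfl, rfl⟩ := gap h2 (by omega) hj
      obtain rfl : x = 0 := by omega
      refine ⟨?_, 2, by simp [offset]⟩
      rw [sup_idem, sup_of_le_right hj.le]
      exact ⟨by ring, by ring⟩
    · exact absurd rfl ha
    · obtain ⟨rfl, rfl, rfl⟩ := gap h2.symm (by omega) hj
      obtain rfl : x' = 0 := by omega
      obtain rfl : x = 0 := by omega
      refine ⟨?_, 0, by simp [offset]⟩
      rw [sup_idem, sup_of_le_left hj.le]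
      exact ⟨by ring, by ring⟩
  · obtain ⟨rfl, rfl, rfl⟩ := gap h1.symm (by omega) hi
    obtain rfl : y' = 0 := by omega
    rcases lt_trichotomy j j' with hj | rfl | hj
    · obtain ⟨rfl, rfl, -⟩ := gap h2 (by omega) hj
      refine ⟨?_, 2, by simp [offset]⟩
      rw [sup_of_le_left hi.le, sup_of_le_right hj.le]
      exact ⟨by ring, by ring⟩
    · obtain rfl : y = 0 := by omega
      refine ⟨?_, 0, by simp [offset]⟩
      rw [sup_of_le_left hi.le, sup_idem]
      exact ⟨by ring, by ring⟩
    · have := gap h2.symm (by omega) hj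
      omega

theorem smul_offset_mem_verts (n : ℕ) (i : Fin 3) : 4 ^ n • offset i ∈ verts n := by
  induction n with
  | zero => revert i; decide
  | succ n ih =>
    simp only [verts, Finset.mem_biUnion, Finset.mem_univ, true_and, Finset.mem_image]
    -- Cells 0, 3 and 6 sit at `3 • offset i`, so their own `i`-th corner is the `i`-th corner of
    -- the whole.
    refine ⟨![0, 3, 6] i, _, ih, ?_⟩
    have : ∀ i, cell (![0, 3, 6] i) = 3 • offset i := by decide
    rw [shift, this]
    ext <;> simp [pow_succ] <;> ring

theorem smul_node_mem_verts (n : ℕ) (p : Fin 15) : 4 ^ n • node p ∈ verts (n + 1) := by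
  obtain ⟨c, i, rfl⟩ := exists_inc_eq p
  simp only [verts, Finset.mem_biUnion, Finset.mem_univ, true_and, Finset.mem_image]
  exact ⟨c, _, smul_offset_mem_verts n i, by rw [node_inc, shift, smul_add]⟩

/-- A node in the triangle of a cell is a corner of this cell. -/
theorem eq_inc_of_shift_eq {n : ℕ} {c : Fin 10} {u : ℕ × ℕ} {p : Fin 15} (hu : u ∈ verts n)
    (h : shift n c u = 4 ^ n • node p) : ∃ i, inc c i = p ∧ u = 4 ^ n • offset i := by
  have hN : 0 < 4 ^ n := by positivity
  have hu' := add_le_of_mem_verts hu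
  have h1 := congrArg Prod.fst h
  have h2 := congrArg Prod.snd h
  simp only [shift, Prod.fst_add, Prod.snd_add, Prod.smul_fst, Prod.smul_snd, smul_eq_mul] at h1 h2
  obtain ⟨i, hi⟩ := exists_inc c p
    ⟨Nat.le_of_mul_le_mul_left (by omega) hN, Nat.le_of_mul_le_mul_left (by omega) hN⟩
    (Nat.le_of_mul_le_mul_left (by linarith) hN)
  refine ⟨i, hi, ?_⟩
  rw [← hi, node_inc, shift, smul_add] at h
  exact add_left_cancel h

/-- The explicit form of the common point, depending on the two cells only, shows that two copies
share at most one vertex. -/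
theorem shift_eq_shift {n : ℕ} {c c' : Fin 10} (hc : c ≠ c') {u u' : ℕ × ℕ} (hu : u ∈ verts n)
    (hu' : u' ∈ verts n) (h : shift n c u = shift n c' u') :
    shift n c u = 4 ^ n • (cell c ⊔ cell c') ∧ ∃ i, u = 4 ^ n • offset i :=
  eq_of_add_eq_add (by positivity) (cell_injective.ne hc) (add_le_of_mem_verts hu)
    (add_le_of_mem_verts hu') h

theorem shift_smul_offset (n : ℕ) (c : Fin 10) (i : Fin 3) :
    shift n c (4 ^ n • offset i) = 4 ^ n • node (inc c i) := by
  rw [node_inc, shift, smul_add]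

/-- The vertices other than corners are disjoint between copies, and the thirty corners of the
copies merge into fifteen nodes: `v' - 15 = 10 * (v - 3)`. -/
theorem card_verts_succ (n : ℕ) : (verts (n + 1)).card + 15 = 10 * (verts n).card := by
  have inj : ∀ {α : Type} {f : α → ℕ × ℕ}, Function.Injective f →
      Function.Injective fun i => 4 ^ n • f i := fun hf a b h =>
    hf (smul_right_injective (ℕ × ℕ) (by positivity : (4 ^ n : ℕ) ≠ 0) h)
  have hcor : (Finset.univ.image fun i => 4 ^ n • offset i).card = 3 := by
    rw [Finset.card_image_of_injective _ (inj offset_injective)]; simp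
  have hnod : (Finset.univ.image fun p => 4 ^ n • node p).card = 15 := by
    rw [Finset.card_image_of_injective _ (inj node_injective)]; simp
  have hcor' : (Finset.univ.image fun i => 4 ^ n • offset i) ⊆ verts n := by
    simp only [Finset.image_subset_iff]
    exact fun i _ => smul_offset_mem_verts n i
  have hnod' : (Finset.univ.image fun p => 4 ^ n • node p) ⊆ verts (n + 1) := by
    simp only [Finset.image_subset_iff]
    exact fun p _ => smul_node_mem_verts n p
  have hun : verts (n + 1) \ (Finset.univ.image fun p => 4 ^ n • node p) =
      Finset.univ.biUnion fun c =>
        (verts n \ (Finset.univ.image fun i => 4 ^ n • offset i)).image (shift n c) := by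
    ext v
    simp only [verts, Finset.mem_sdiff, Finset.mem_biUnion, Finset.mem_univ, true_and,
      Finset.mem_image, not_exists]
    constructor
    · rintro ⟨⟨c, u, hu, rfl⟩, hv⟩
      exact ⟨c, u, ⟨hu, fun i hi => hv (inc c i) (by rw [← hi, shift_smul_offset])⟩, rfl⟩
    · rintro ⟨c, u, ⟨hu, hi⟩, rfl⟩
      refine ⟨⟨c, u, hu, rfl⟩, fun p hp => ?_⟩
      obtain ⟨i, -, h⟩ := eq_inc_of_shift_eq hu hp.symm
      exact hi i h.symm
  have hcard := congrArg Finset.card hun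
  rw [Finset.card_biUnion] at hcard
  · simp only [Finset.card_image_of_injective _ (shift_injective n _),
      Finset.card_sdiff_of_subset hcor', Finset.card_sdiff_of_subset hnod', hcor, hnod,
      Finset.sum_const, Finset.card_univ, Fintype.card_fin, smul_eq_mul] at hcard
    have h1 := Finset.card_le_card hcor'
    have h2 := Finset.card_le_card hnod'
    omega
  · intro c _ c' _ hne
    rw [Function.onFun, Finset.disjoint_left]
    intro v hv hv'
    simp only [Finset.mem_sdiff, Finset.mem_univ, true_and, Finset.mem_image, not_exists] at hv hv'
    obtain ⟨u, ⟨hu, hi⟩, rfl⟩ := hv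
    obtain ⟨u', ⟨hu', -⟩, h⟩ := hv'
    obtain ⟨-, i, rfl⟩ := shift_eq_shift hne hu hu' h.symm
    exact hi i rfl

theorem three_mul_card_verts (n : ℕ) : 3 * (verts n).card = 4 * 10 ^ n + 5 := by
  induction n with
  | zero => rfl
  | succ n ih =>
    have := card_verts_succ n
    rw [pow_succ]
    omega

theorem natCard_verts (n : ℕ) : Nat.card (gasket 4 n).verts = (verts n).card := by
  rw [← Nat.card_eq_finsetCard]
  exact Nat.card_congr (Equiv.subtypeEquivRight (mem_verts_iff n))

end Geometry

/-! ### Counts with prescribed corners as a sum over assignments of nodes to copies -/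

section Recursion

/-- The number of matchings of stage `n` with prescribed coverage of the three corners. -/
def count (n : ℕ) (x y z : Bool) : ℕ :=
  Finset.card {M ∈ matchings (edges n) |
    ∀ i, Covers M (4 ^ n • offset i) ↔ (![x, y, z] : Fin 3 → Bool) i = true}

theorem independent_image {V W : Type*} [DecidableEq W] {f : V → W}
    (hf : Function.Injective f) {M : Finset (Sym2 V)} :
    Independent (M.image (Sym2.map f)) ↔ Independent M := by
  simp only [Independent, Finset.forall_mem_image]
  refine forall₂_congr fun e _ => forall₂_congr fun e' _ => ⟨fun h v hv hv' => ?_, ?_⟩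
  · exact Sym2.map.injective hf (h (f v) (Sym2.mem_map.2 ⟨v, hv, rfl⟩) (Sym2.mem_map.2 ⟨v, hv', rfl⟩))
  · intro h v hv hv'
    obtain ⟨a, ha, rfl⟩ := Sym2.mem_map.1 hv
    obtain ⟨b, hb, hab⟩ := Sym2.mem_map.1 hv'
    obtain rfl := hf hab
    rw [h _ ha hb]

theorem covers_image {V W : Type*} [DecidableEq W] {f : V → W} {M : Finset (Sym2 V)} {v : W} :
    Covers (M.image (Sym2.map f)) v ↔ ∃ u, f u = v ∧ Covers M u := by
  simp only [Covers, Finset.exists_mem_image, Sym2.mem_map]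
  grind

theorem card_matchings_image {V W : Type*} [DecidableEq V] [DecidableEq W] {f : V → W}
    (hf : Function.Injective f) (E : Finset (Sym2 V)) (Q : Finset (Sym2 W) → Prop)
    [DecidablePred Q] :
    Finset.card {M ∈ matchings (E.image (Sym2.map f)) | Q M} =
    Finset.card {M ∈ matchings E | Q (M.image (Sym2.map f))} := by
  symm
  refine Finset.card_bij (fun M _ => M.image (Sym2.map f)) ?_ ?_ ?_
  · intro M hM
    rw [Finset.mem_filter, mem_matchings] at hM ⊢
    exact ⟨⟨Finset.image_subset_image hM.1.1, (independent_image hf).2 hM.1.2⟩, hM.2⟩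
  · intro M _ N _ h
    exact Finset.image_injective (Sym2.map.injective hf) h
  · intro M hM
    rw [Finset.mem_filter, mem_matchings] at hM
    obtain ⟨N, hN, rfl⟩ := Finset.subset_image_iff.1 hM.1.1
    refine ⟨N, ?_, rfl⟩
    rw [Finset.mem_filter, mem_matchings]
    exact ⟨⟨hN, (independent_image hf).1 hM.1.2⟩, hM.2⟩

/-- The copy of the edges of stage `n` in the cell `c`. -/
def copyEdges (n : ℕ) (c : Fin 10) : Finset (Sym2 (ℕ × ℕ)) :=
  (edges n).image (Sym2.map (shift n c))

theorem covers_copy_node {n : ℕ} {c : Fin 10} {M : Finset (Sym2 (ℕ × ℕ))} (hM : M ⊆ edges n)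
    {p : Fin 15} : Covers (M.image (Sym2.map (shift n c))) (4 ^ n • node p) ↔
      ∃ i, inc c i = p ∧ Covers M (4 ^ n • offset i) := by
  rw [covers_image]
  constructor
  · rintro ⟨u, hu, e, he, hv⟩
    obtain ⟨i, hi, rfl⟩ := eq_inc_of_shift_eq (mem_verts_of_mem_edges (hM he) hv) hu
    exact ⟨i, hi, e, he, hv⟩
  · rintro ⟨i, rfl, hi⟩
    exact ⟨_, shift_smul_offset n c i, hi⟩

theorem inc_injective : ∀ c, Function.Injective (inc c) := by
  unfold Function.Injective; decide

/-- The number of matchings of a copy of stage `n` that cover exactly the nodes that are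
assigned to this copy. -/
theorem card_matchings_copy (n : ℕ) (c : Fin 10) (q : Fin 15 → Option (Fin 10))
    (hq : ∀ p, q p = some c → ∃ i, inc c i = p) :
    Finset.card {M ∈ matchings (copyEdges n c) | ∀ p, Covers M (4 ^ n • node p) ↔ q p = some c} =
    count n (decide (q (inc c 0) = some c)) (decide (q (inc c 1) = some c))
      (decide (q (inc c 2) = some c)) := by
  rw [copyEdges, card_matchings_image (shift_injective n c), count]
  congr 1
  refine Finset.filter_congr fun M hM => ?_
  have hM' := (mem_matchings.1 hM).1
  simp only [covers_copy_node hM']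
  have : ∀ i, (![decide (q (inc c 0) = some c), decide (q (inc c 1) = some c),
      decide (q (inc c 2) = some c)] : Fin 3 → Bool) i = true ↔ q (inc c i) = some c := by
    intro i
    fin_cases i <;> simp
  simp only [this]
  constructor
  · intro h i
    rw [← h (inc c i)]
    exact ⟨fun hi => ⟨i, rfl, hi⟩, fun ⟨i', hi', hi⟩ => inc_injective c hi' ▸ hi⟩
  · intro h p
    constructor
    · rintro ⟨i, rfl, hi⟩
      exact (h i).1 hi
    · intro hp
      obtain ⟨i, rfl⟩ := hq p hp
      exact ⟨i, rfl, (h i).2 hp⟩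

/-- Discards the assignments that give a node to a copy not containing it, so that the sum can be
restricted to `choices`. -/
theorem card_matchings_copy_eq_zero (n : ℕ) (c : Fin 10) (q : Fin 15 → Option (Fin 10))
    {p : Fin 15} (hp : q p = some c) (hc : ∀ i, inc c i ≠ p) :
    Finset.card {M ∈ matchings (copyEdges n c) | ∀ p, Covers M (4 ^ n • node p) ↔ q p = some c} =
    0 := by
  rw [copyEdges, card_matchings_image (shift_injective n c), Finset.card_eq_zero,
    Finset.filter_eq_empty_iff]
  intro M hM h
  obtain ⟨i, hi, -⟩ := (covers_copy_node (mem_matchings.1 hM).1).1 ((h p).2 hp)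
  exact hc i hi

/-- The copies that may cover the node `p`, or `none` if it may be left uncovered, for prescribed
coverage of the three corners. -/
def choices (x y z : Bool) (p : Fin 15) : Finset (Option (Fin 10)) :=
  {o | (∀ c, o = some c → ∃ i, inc c i = p) ∧
    ∀ i : Fin 3, i.castLE (by decide) = p → (o ≠ none ↔ (![x, y, z] : Fin 3 → Bool) i = true)}

theorem choices_eq : ∀ x y z, choices x y z =
    ![bif x then {some 0} else {none}, bif y then {some 3} else {none},
      bif z then {some 6} else {none}, {none, some 1, some 4}, {none, some 5, some 8},
      {none, some 2, some 7}, {none, some 1, some 2, some 9}, {none, some 4, some 5, some 9},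
      {none, some 7, some 8, some 9}, {none, some 0, some 1}, {none, some 0, some 2},
      {none, some 3, some 4}, {none, some 3, some 5}, {none, some 6, some 7},
      {none, some 6, some 8}] := by
  decide +kernel

/-- The weight of a choice of the copies that cover the nodes. -/
def choiceWeight {R : Type*} [CommSemiring R] (w : Bool → Bool → Bool → R)
    (q : Fin 15 → Option (Fin 10)) : R :=
  ∏ c, w (decide (q (inc c 0) = some c)) (decide (q (inc c 1) = some c))
    (decide (q (inc c 2) = some c))

/-- Matchings are sorted by the copy that covers each node. Once this is fixed, the copies are
independent and each contributes a `count n`. -/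
theorem count_succ_eq_sum (n : ℕ) (x y z : Bool) :
    count (n + 1) x y z = ∑ q ∈ Fintype.piFinset (choices x y z), choiceWeight (count n) q := by
  -- The formula for the common vertex serves edge-disjointness: both ends of a common edge would be
  -- this one vertex, making the edge a loop.
  have hmeet : ∀ c c', c ≠ c' → ∀ e ∈ copyEdges n c, ∀ e' ∈ copyEdges n c', ∀ v, v ∈ e → v ∈ e' →
      v = 4 ^ n • (cell c ⊔ cell c') ∧ ∃ p, 4 ^ n • node p = v := by
    intro c c' hc e he e' he' v hv hv'
    obtain ⟨f, hf, rfl⟩ := Finset.mem_image.1 he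
    obtain ⟨f', hf', rfl⟩ := Finset.mem_image.1 he'
    obtain ⟨u, hu, rfl⟩ := Sym2.mem_map.1 hv
    obtain ⟨u', hu', h⟩ := Sym2.mem_map.1 hv'
    obtain ⟨h1, i, rfl⟩ := shift_eq_shift hc (mem_verts_of_mem_edges hf hu)
      (mem_verts_of_mem_edges hf' hu') h.symm
    exact ⟨h1, inc c i, (shift_smul_offset n c i).symm⟩
  have hdisj : ∀ c c', c ≠ c' → Disjoint (copyEdges n c) (copyEdges n c') := by
    intro c c' hc
    rw [Finset.disjoint_left]
    intro e he he'
    have h := hmeet c c' hc e he e he'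
    have hd : ¬ e.IsDiag := by
      obtain ⟨f, hf, rfl⟩ := Finset.mem_image.1 he
      rw [Sym2.isDiag_map (shift_injective n c)]
      exact not_isDiag_of_mem_edges hf
    induction e using Sym2.ind with
    | _ a b =>
      have ha := (h a (by simp) (by simp)).1
      have hb := (h b (by simp) (by simp)).1
      exact hd (Sym2.mk_isDiag_iff.2 (ha.trans hb.symm))
  have hnode : ∀ i : Fin 3, 4 ^ (n + 1) • offset i = 4 ^ n • node (i.castLE (by decide)) := by
    intro i
    have : ∀ i : Fin 3, node (i.castLE (by decide)) = 4 • offset i := by decide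
    rw [this, smul_smul, pow_succ]
  rw [count]
  simp only [hnode]
  have key : Finset.card {M ∈ matchings (edges (n + 1)) |
      ∀ i : Fin 3, Covers M (4 ^ n • node (i.castLE (by decide))) ↔
        (![x, y, z] : Fin 3 → Bool) i = true} =
      ∑ q : Fin 15 → Option (Fin 10) with
        ∀ i : Fin 3, q (i.castLE (by decide)) ≠ none ↔ (![x, y, z] : Fin 3 → Bool) i = true,
      ∏ c, Finset.card {M ∈ matchings (copyEdges n c) |
        ∀ p, Covers M (4 ^ n • node p) ↔ q p = some c} := by
    convert card_matchings_covers (copyEdges n) (fun p => 4 ^ n • node p) hdisj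
      (fun c c' hc e he e' he' v hv hv' => (hmeet c c' hc e he e' he' v hv hv').2)
      (fun i : Fin 3 => i.castLE (by decide)) ![x, y, z]
    rfl
  refine key.trans ?_
  symm
  refine (Finset.sum_congr rfl fun q hq => ?_).trans (Finset.sum_subset
    (s₁ := Fintype.piFinset (choices x y z)) (fun q hq => ?_) fun q hq hq' => ?_)
  · rw [Fintype.mem_piFinset] at hq
    refine Finset.prod_congr rfl fun c _ => (card_matchings_copy n c q fun p hp => ?_).symm
    exact (Finset.mem_filter.1 (hq p)).2.1 c hp
  · rw [Fintype.mem_piFinset] at hq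
    rw [Finset.mem_filter]
    exact ⟨Finset.mem_univ _, fun i => (Finset.mem_filter.1 (hq _)).2.2 i rfl⟩
  · rw [Fintype.mem_piFinset, not_forall] at hq'
    obtain ⟨p, hp⟩ := hq'
    have hs := (Finset.mem_filter.1 hq).2
    -- The corner conditions already hold for `q`, so leaving `choices` can only mean a node
    -- assigned to a copy away from it.
    have : ∃ c, q p = some c ∧ ∀ i, inc c i ≠ p := by
      by_contra! hcon
      refine hp (Finset.mem_filter.2 ⟨Finset.mem_univ _, fun c hc => hcon c hc, ?_⟩)
      rintro i rfl
      exact hs i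
    obtain ⟨c, hc, hi⟩ := this
    exact Finset.prod_eq_zero (Finset.mem_univ c) (card_matchings_copy_eq_zero n c q hc hi)

end Recursion

/-! ### Factorization of the sum into three corner blocks and the central copy -/

section Step

variable {R : Type*} [CommSemiring R]

/-- The sum over the states of a node that lies in two copies: each of them may cover it, but
not both. -/
def sumTwo (F : Bool → Bool → R) : R := F false false + F true false + F false true

/-- The sum over the states of a node that lies in three copies. -/
def sumThree (F : Bool → Bool → Bool → R) : R :=
  F false false false + F true false false + F false true false + F false false true

theorem sumTwo_mul_left (a : R) (F : Bool → Bool → R) :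
    sumTwo (fun s t => a * F s t) = a * sumTwo F := by
  simp only [sumTwo, mul_add]

theorem sumTwo_mul_right (F : Bool → Bool → R) (a : R) :
    sumTwo (fun s t => F s t * a) = sumTwo F * a := by
  simp only [sumTwo, add_mul]

theorem sum_eq_sumTwo {c c' : Fin 10} (h : c ≠ c') {f : Option (Fin 10) → R} {F : Bool → Bool → R}
    (hf : ∀ o, f o = F (decide (o = some c)) (decide (o = some c'))) :
    ∑ o ∈ {none, some c, some c'}, f o = sumTwo F := by
  rw [Finset.sum_insert (by simp), Finset.sum_insert (by simpa using h), Finset.sum_singleton,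
    sumTwo]
  simp [hf, h, h.symm, add_assoc]

theorem sum_eq_sumThree {c c' c'' : Fin 10} (h : c ≠ c') (h' : c ≠ c'') (h'' : c' ≠ c'')
    {f : Option (Fin 10) → R} {F : Bool → Bool → Bool → R}
    (hf : ∀ o, f o = F (decide (o = some c)) (decide (o = some c')) (decide (o = some c''))) :
    ∑ o ∈ {none, some c, some c', some c''}, f o = sumThree F := by
  rw [Finset.sum_insert (by simp), Finset.sum_insert (by simp [h, h']),
    Finset.sum_insert (by simp [h'']), Finset.sum_singleton, sumThree]
  simp [hf, h, h.symm, h', h'.symm, h'', h''.symm, add_assoc]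

theorem sum_bif {c : Fin 10} {x : Bool} {f : Option (Fin 10) → R} (F : Bool → R)
    (hf : ∀ o, f o = F (decide (o = some c))) :
    ∑ o ∈ bif x then {some c} else {none}, f o = F x := by
  cases x <;> simp [hf]

theorem sum_piFinset_vecCons {α : Type*} {n : ℕ} (B : Finset α) (A : Fin n → Finset α)
    (F : (Fin (n + 1) → α) → R) :
    ∑ q ∈ Fintype.piFinset (Matrix.vecCons B A), F q =
      ∑ a ∈ B, ∑ q ∈ Fintype.piFinset A, F (Matrix.vecCons a q) := by
  rw [← Finset.sum_product']
  symm
  refine Finset.sum_bij' (fun p _ => Matrix.vecCons p.1 p.2)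
    (fun q _ => (Matrix.vecHead q, Matrix.vecTail q)) ?_ ?_ ?_ ?_ ?_
  · rintro ⟨a, q⟩ h
    rw [Finset.mem_product, Fintype.mem_piFinset] at h
    rw [Fintype.mem_piFinset, Fin.forall_fin_succ]
    exact h
  · intro q h
    rw [Fintype.mem_piFinset, Fin.forall_fin_succ] at h
    rw [Finset.mem_product, Fintype.mem_piFinset]
    exact h
  · rintro ⟨a, q⟩ _
    simp
  · intro q _
    simp
  · intro _ _
    rfl

theorem sum_piFinset_vecEmpty {α : Type*} (F : (Fin 0 → α) → R) :
    ∑ q ∈ Fintype.piFinset (![] : Fin 0 → Finset α), F q = F ![] := by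
  rw [Fintype.piFinset_of_isEmpty, Finset.univ_unique, Finset.sum_singleton]
  congr 1

/-- The three copies near the corner `(0, 0)`: the copy at the corner has the weight `p`, and the
coverage is `m` for `(2, 0)`, `m'` for `(0, 2)`, and `a`, `a'` for `(1, 1)`. -/
def blockOne (w : Bool → Bool → Bool → R) (p : Bool → Bool → R) (m m' a a' : Bool) : R :=
  sumTwo fun u u' => sumTwo fun v v' => p u v * w u' m a * w v' a' m'

/-- The three copies near the corner `(4, 0)`. -/
def blockTwo (w : Bool → Bool → Bool → R) (p : Bool → Bool → R) (m m' b b' : Bool) : R :=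
  sumTwo fun u u' => sumTwo fun v v' => p u v * w m u' b * w b' v' m'

/-- The three copies near the corner `(0, 4)`. -/
def blockThree (w : Bool → Bool → Bool → R) (p : Bool → Bool → R) (m m' c c' : Bool) : R :=
  sumTwo fun u u' => sumTwo fun v v' => p u v * w m c u' * w c' m' v'

/-- The sum over the coverage of the inner node of a block, where `k` tells whether this node
is covered by the central copy. -/
def sumInner (F : Bool → Bool → R) (k : Bool) : R := bif k then F false false else sumTwo F

/-- The sum over the coverage of the three inner nodes. -/
def sumCenter (w : Bool → Bool → Bool → R) (F G H : Bool → R) : R :=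
  w false false false * F false * G false * H false +
  w true false false * F true * G false * H false +
  w false true false * F false * G true * H false +
  w true true false * F true * G true * H false +
  w false false true * F false * G false * H true +
  w true false true * F true * G false * H true +
  w false true true * F false * G true * H true +
  w true true true * F true * G true * H true

/-- The sum over the coverage of all nodes except the three corners, where the three copies at the
corners have the weights `p₁`, `p₂`, `p₃` and the other seven have the weight `w`. -/
def sumNodes (w : Bool → Bool → Bool → R) (p₁ p₂ p₃ : Bool → Bool → R) : R :=
  sumTwo fun m₁ m₁' => sumTwo fun m₂ m₂' => sumTwo fun m₃ m₃' =>
    sumCenter w (sumInner (blockOne w p₁ m₁ m₃)) (sumInner (blockTwo w p₂ m₁' m₂))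
      (sumInner (blockThree w p₃ m₃' m₂'))

/-- The passage from the numbers of matchings of stage `n` with prescribed coverage of the corners
to those of stage `n + 1`. -/
def step (w : Bool → Bool → Bool → R) (x y z : Bool) : R :=
  sumNodes w (w x) (fun u v => w u y v) (fun u v => w u v z)

/-- Each inner node lies in two copies of one block and in the central copy. For fixed coverage by
the central copy the three blocks separate. -/
theorem sumThree_sumThree_sumThree (w : Bool → Bool → Bool → R) (F G H : Bool → Bool → R) :
    (sumThree fun a a' a'' => sumThree fun b b' b'' => sumThree fun c c' c'' =>
      F a a' * (G b b' * (H c c' * w a'' b'' c''))) =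
    sumCenter w (sumInner F) (sumInner G) (sumInner H) := by
  have hmul : ∀ (a : R) (K : Bool → Bool → Bool → R),
      sumThree (fun s t r => a * K s t r) = a * sumThree K := by
    intro a K; simp only [sumThree, mul_add]
  have h : ∀ (K : Bool → Bool → R) (L : Bool → R), sumThree (fun s t r => K s t * L r) =
      sumInner K false * L false + sumInner K true * L true := by
    intro K L
    simp only [sumThree, sumInner, sumTwo, cond_true, cond_false]
    ring
  simp only [hmul, h, sumCenter]
  ring

/-- Once the three midpoints and the coverage by the central copy are fixed, the corner blocks no
longer interact. Thus the sum over up to `3 ^ 9 * 4 ^ 3` assignments becomes a nested expression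
that can be evaluated exactly. -/
theorem sum_choiceWeight (w : Bool → Bool → Bool → R) (x y z : Bool) :
    ∑ q ∈ Fintype.piFinset (choices x y z), choiceWeight w q = step w x y z := by
  rw [choices_eq]
  have hw : ∀ o0 o1 o2 o3 o4 o5 o6 o7 o8 o9 o10 o11 o12 o13 o14 : Option (Fin 10),
      choiceWeight w ![o0, o1, o2, o3, o4, o5, o6, o7, o8, o9, o10, o11, o12, o13, o14] =
      w (decide (o0 = some 0)) (decide (o9 = some 0)) (decide (o10 = some 0)) *
      w (decide (o9 = some 1)) (decide (o3 = some 1)) (decide (o6 = some 1)) *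
      w (decide (o10 = some 2)) (decide (o6 = some 2)) (decide (o5 = some 2)) *
      ((w (decide (o11 = some 3)) (decide (o1 = some 3)) (decide (o12 = some 3)) *
      w (decide (o3 = some 4)) (decide (o11 = some 4)) (decide (o7 = some 4)) *
      w (decide (o7 = some 5)) (decide (o12 = some 5)) (decide (o4 = some 5))) *
      ((w (decide (o13 = some 6)) (decide (o14 = some 6)) (decide (o2 = some 6)) *
      w (decide (o5 = some 7)) (decide (o8 = some 7)) (decide (o13 = some 7)) *
      w (decide (o8 = some 8)) (decide (o4 = some 8)) (decide (o14 = some 8))) *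
      w (decide (o6 = some 9)) (decide (o7 = some 9)) (decide (o8 = some 9)))) := by
    intros
    simp only [choiceWeight, Fin.prod_univ_succ, Finset.univ_eq_empty, Finset.prod_empty, mul_one,
      mul_assoc]
    rfl
  rw [sum_piFinset_vecCons]
  refine sum_bif (fun x => step w x y z) fun o0 => ?_
  rw [sum_piFinset_vecCons]
  refine sum_bif (fun y => step w _ y z) fun o1 => ?_
  rw [sum_piFinset_vecCons]
  refine sum_bif (fun z => step w _ _ z) fun o2 => ?_
  rw [step, sumNodes]
  rw [sum_piFinset_vecCons]
  refine sum_eq_sumTwo (by decide) fun o3 => ?_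
  rw [sum_piFinset_vecCons]
  refine sum_eq_sumTwo (by decide) fun o4 => ?_
  rw [sum_piFinset_vecCons]
  refine sum_eq_sumTwo (by decide) fun o5 => ?_
  rw [← sumThree_sumThree_sumThree]
  rw [sum_piFinset_vecCons]
  refine sum_eq_sumThree (by decide) (by decide) (by decide) fun o6 => ?_
  rw [sum_piFinset_vecCons]
  refine sum_eq_sumThree (by decide) (by decide) (by decide) fun o7 => ?_
  rw [sum_piFinset_vecCons]
  refine sum_eq_sumThree (by decide) (by decide) (by decide) fun o8 => ?_
  -- The remaining factors are moved inside the sums of each block, so that nodes 9 to 14 can be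
  -- peeled off two at a time.
  simp only [blockOne, blockTwo, blockThree, ← sumTwo_mul_right]
  rw [sum_piFinset_vecCons]
  refine sum_eq_sumTwo (by decide) fun o9 => ?_
  rw [sum_piFinset_vecCons]
  refine sum_eq_sumTwo (by decide) fun o10 => ?_
  simp only [← sumTwo_mul_left]
  rw [sum_piFinset_vecCons]
  refine sum_eq_sumTwo (by decide) fun o11 => ?_
  rw [sum_piFinset_vecCons]
  refine sum_eq_sumTwo (by decide) fun o12 => ?_
  rw [sum_piFinset_vecCons]
  refine sum_eq_sumTwo (by decide) fun o13 => ?_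
  rw [sum_piFinset_vecCons]
  refine sum_eq_sumTwo (by decide) fun o14 => ?_
  rw [sum_piFinset_vecEmpty, hw]

theorem count_succ (n : ℕ) : count (n + 1) = step (count n) := by
  funext x y z
  rw [count_succ_eq_sum, sum_choiceWeight]

end Step

/-! ### Exact counts at stages 0, 1 and 2 -/

section Values

/-- The symmetric function of three states with given values for `0`, `1`, `2` and `3` covered
corners. -/
def symm (f g h t : ℕ) (x y z : Bool) : ℕ :=
  bif x then (bif y then (bif z then t else h) else (bif z then h else g))
  else (bif y then (bif z then h else g) else (bif z then g else f))

theorem count_zero : count 0 = symm 1 0 1 0 := by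
  have : ∀ x y z, count 0 x y z = symm 1 0 1 0 x y z := by decide +kernel
  funext x y z
  exact this x y z

theorem count_one : count 1 = symm 2220 1914 1640 1396 := by
  rw [count_succ, count_zero]
  have : ∀ x y z, step (symm 1 0 1 0) x y z = symm 2220 1914 1640 1396 x y z := by decide +kernel
  funext x y z
  exact this x y z

theorem count_two : count 2 = symm 1095249688634151454219516689432826798080
    940563707718765231855988194853818067968 807724574091886425362687789454449995776
    693646780368841817581399832196591292416 := by
  rw [count_succ, count_one]
  have : ∀ x y z, step (symm 2220 1914 1640 1396) x y z =
      symm 1095249688634151454219516689432826798080 940563707718765231855988194853818067968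
        807724574091886425362687789454449995776 693646780368841817581399832196591292416 x y z := by
    decide +kernel
  funext x y z
  exact this x y z

end Values

/-! ### Monotonicity, linearity at the corners, and invariance of ratio bounds -/

section Bounds

theorem sumTwo_mono {F G : Bool → Bool → ℝ} (h : ∀ s t, F s t ≤ G s t) : sumTwo F ≤ sumTwo G :=
  add_le_add (add_le_add (h _ _) (h _ _)) (h _ _)

theorem sumTwo_nonneg {F : Bool → Bool → ℝ} (h : ∀ s t, 0 ≤ F s t) : 0 ≤ sumTwo F :=
  add_nonneg (add_nonneg (h _ _) (h _ _)) (h _ _)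

theorem sumInner_mono {F G : Bool → Bool → ℝ} (h : ∀ s t, F s t ≤ G s t) (k : Bool) :
    sumInner F k ≤ sumInner G k := by
  cases k
  · exact sumTwo_mono h
  · exact h _ _

theorem sumInner_nonneg {F : Bool → Bool → ℝ} (h : ∀ s t, 0 ≤ F s t) (k : Bool) :
    0 ≤ sumInner F k := by
  cases k
  · exact sumTwo_nonneg h
  · exact h _ _

theorem mul_mul_le_mul_mul {a a' b b' c c' : ℝ} (ha : 0 ≤ a) (hb : 0 ≤ b) (hc : 0 ≤ c)
    (haa : a ≤ a') (hbb : b ≤ b') (hcc : c ≤ c') : a * b * c ≤ a' * b' * c' :=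
  mul_le_mul (mul_le_mul haa hbb hb (ha.trans haa)) hcc hc
    (mul_nonneg (ha.trans haa) (hb.trans hbb))

theorem sumCenter_mono {w w' : Bool → Bool → Bool → ℝ} {F F' G G' H H' : Bool → ℝ}
    (hw₀ : ∀ x y z, 0 ≤ w x y z) (hw : ∀ x y z, w x y z ≤ w' x y z)
    (hF₀ : ∀ k, 0 ≤ F k) (hF : ∀ k, F k ≤ F' k) (hG₀ : ∀ k, 0 ≤ G k) (hG : ∀ k, G k ≤ G' k)
    (hH₀ : ∀ k, 0 ≤ H k) (hH : ∀ k, H k ≤ H' k) :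
    sumCenter w F G H ≤ sumCenter w' F' G' H' := by
  have h : ∀ x y z, w x y z * F x * G y * H z ≤ w' x y z * F' x * G' y * H' z := fun x y z =>
    mul_le_mul (mul_mul_le_mul_mul (hw₀ _ _ _) (hF₀ _) (hG₀ _) (hw _ _ _) (hF _) (hG _)) (hH _)
      (hH₀ _) (mul_nonneg (mul_nonneg ((hw₀ _ _ _).trans (hw _ _ _)) ((hF₀ _).trans (hF _)))
        ((hG₀ _).trans (hG _)))
  unfold sumCenter
  linarith [h false false false, h true false false, h false true false, h true true false,
    h false false true, h true false true, h false true true, h true true true]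

/-- The sum over the states of the nodes is monotone in all weights. -/
theorem sumNodes_mono {w w' : Bool → Bool → Bool → ℝ} {p₁ p₁' p₂ p₂' p₃ p₃' : Bool → Bool → ℝ}
    (hw₀ : ∀ x y z, 0 ≤ w x y z) (hw : ∀ x y z, w x y z ≤ w' x y z)
    (h₁₀ : ∀ u v, 0 ≤ p₁ u v) (h₁ : ∀ u v, p₁ u v ≤ p₁' u v)
    (h₂₀ : ∀ u v, 0 ≤ p₂ u v) (h₂ : ∀ u v, p₂ u v ≤ p₂' u v)
    (h₃₀ : ∀ u v, 0 ≤ p₃ u v) (h₃ : ∀ u v, p₃ u v ≤ p₃' u v) :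
    sumNodes w p₁ p₂ p₃ ≤ sumNodes w' p₁' p₂' p₃' := by
  refine sumTwo_mono fun _ _ => sumTwo_mono fun _ _ => sumTwo_mono fun _ _ =>
    sumCenter_mono hw₀ hw ?_ ?_ ?_ ?_ ?_ ?_
  · exact sumInner_nonneg fun _ _ => sumTwo_nonneg fun _ _ => sumTwo_nonneg fun _ _ =>
      mul_nonneg (mul_nonneg (h₁₀ _ _) (hw₀ _ _ _)) (hw₀ _ _ _)
  · exact sumInner_mono fun _ _ => sumTwo_mono fun _ _ => sumTwo_mono fun _ _ =>
      mul_mul_le_mul_mul (h₁₀ _ _) (hw₀ _ _ _) (hw₀ _ _ _) (h₁ _ _) (hw _ _ _) (hw _ _ _)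
  · exact sumInner_nonneg fun _ _ => sumTwo_nonneg fun _ _ => sumTwo_nonneg fun _ _ =>
      mul_nonneg (mul_nonneg (h₂₀ _ _) (hw₀ _ _ _)) (hw₀ _ _ _)
  · exact sumInner_mono fun _ _ => sumTwo_mono fun _ _ => sumTwo_mono fun _ _ =>
      mul_mul_le_mul_mul (h₂₀ _ _) (hw₀ _ _ _) (hw₀ _ _ _) (h₂ _ _) (hw _ _ _) (hw _ _ _)
  · exact sumInner_nonneg fun _ _ => sumTwo_nonneg fun _ _ => sumTwo_nonneg fun _ _ =>
      mul_nonneg (mul_nonneg (h₃₀ _ _) (hw₀ _ _ _)) (hw₀ _ _ _)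
  · exact sumInner_mono fun _ _ => sumTwo_mono fun _ _ => sumTwo_mono fun _ _ =>
      mul_mul_le_mul_mul (h₃₀ _ _) (hw₀ _ _ _) (hw₀ _ _ _) (h₃ _ _) (hw _ _ _) (hw _ _ _)

theorem sumInner_mul_left (r : ℝ) (F : Bool → Bool → ℝ) :
    sumInner (fun s t => r * F s t) = fun k => r * sumInner F k := by
  funext k
  cases k
  · exact sumTwo_mul_left r F
  · rfl

/-- Exactly one factor of every term comes from the copy at a given outer corner; this linearity is
what carries ratio bounds through `step`. -/
theorem sumNodes_mul_one (w : Bool → Bool → Bool → ℝ) (r : ℝ) (p₁ p₂ p₃ : Bool → Bool → ℝ) :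
    sumNodes w (fun u v => r * p₁ u v) p₂ p₃ = r * sumNodes w p₁ p₂ p₃ := by
  have hb : ∀ m m', blockOne w (fun u v => r * p₁ u v) m m' =
      fun a a' => r * blockOne w p₁ m m' a a' := by
    intro m m'
    funext a a'
    simp only [blockOne, ← sumTwo_mul_left, mul_assoc]
  have hc : ∀ F G H : Bool → ℝ, sumCenter w (fun k => r * F k) G H = r * sumCenter w F G H := by
    intro F G H
    unfold sumCenter
    ring
  simp only [sumNodes, hb, sumInner_mul_left, hc, sumTwo_mul_left]

theorem sumNodes_mul_two (w : Bool → Bool → Bool → ℝ) (r : ℝ) (p₁ p₂ p₃ : Bool → Bool → ℝ) :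
    sumNodes w p₁ (fun u v => r * p₂ u v) p₃ = r * sumNodes w p₁ p₂ p₃ := by
  have hb : ∀ m m', blockTwo w (fun u v => r * p₂ u v) m m' =
      fun a a' => r * blockTwo w p₂ m m' a a' := by
    intro m m'
    funext a a'
    simp only [blockTwo, ← sumTwo_mul_left, mul_assoc]
  have hc : ∀ F G H : Bool → ℝ, sumCenter w F (fun k => r * G k) H = r * sumCenter w F G H := by
    intro F G H
    unfold sumCenter
    ring
  simp only [sumNodes, hb, sumInner_mul_left, hc, sumTwo_mul_left]

theorem sumNodes_mul_three (w : Bool → Bool → Bool → ℝ) (r : ℝ) (p₁ p₂ p₃ : Bool → Bool → ℝ) :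
    sumNodes w p₁ p₂ (fun u v => r * p₃ u v) = r * sumNodes w p₁ p₂ p₃ := by
  have hb : ∀ m m', blockThree w (fun u v => r * p₃ u v) m m' =
      fun a a' => r * blockThree w p₃ m m' a a' := by
    intro m m'
    funext a a'
    simp only [blockThree, ← sumTwo_mul_left, mul_assoc]
  have hc : ∀ F G H : Bool → ℝ, sumCenter w F G (fun k => r * H k) = r * sumCenter w F G H := by
    intro F G H
    unfold sumCenter
    ring
  simp only [sumNodes, hb, sumInner_mul_left, hc, sumTwo_mul_left]

theorem cast_step (w : Bool → Bool → Bool → ℕ) (x y z : Bool) :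
    ((step w x y z : ℕ) : ℝ) = step (fun x y z => (w x y z : ℝ)) x y z := by
  have h2 : ∀ F : Bool → Bool → ℕ, ((sumTwo F : ℕ) : ℝ) = sumTwo fun s t => (F s t : ℝ) := by
    intro F
    simp only [sumTwo, Nat.cast_add]
  have hi : ∀ (F : Bool → Bool → ℕ) k,
      ((sumInner F k : ℕ) : ℝ) = sumInner (fun s t => (F s t : ℝ)) k := by
    intro F k
    cases k
    · exact h2 F
    · rfl
  have hc : ∀ F G H : Bool → ℕ, ((sumCenter w F G H : ℕ) : ℝ) =
      sumCenter (fun x y z => (w x y z : ℝ)) (fun k => (F k : ℝ)) (fun k => (G k : ℝ))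
        (fun k => (H k : ℝ)) := by
    intro F G H
    simp only [sumCenter, Nat.cast_add, Nat.cast_mul]
  have h1 : ∀ p m m', (fun a a' => ((blockOne w p m m' a a' : ℕ) : ℝ)) =
      blockOne (fun x y z => (w x y z : ℝ)) (fun u v => (p u v : ℝ)) m m' := by
    intro p m m'
    funext a a'
    simp only [blockOne, h2, Nat.cast_mul]
  have h2' : ∀ p m m', (fun a a' => ((blockTwo w p m m' a a' : ℕ) : ℝ)) =
      blockTwo (fun x y z => (w x y z : ℝ)) (fun u v => (p u v : ℝ)) m m' := by
    intro p m m'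
    funext a a'
    simp only [blockTwo, h2, Nat.cast_mul]
  have h3 : ∀ p m m', (fun a a' => ((blockThree w p m m' a a' : ℕ) : ℝ)) =
      blockThree (fun x y z => (w x y z : ℝ)) (fun u v => (p u v : ℝ)) m m' := by
    intro p m m'
    funext a a'
    simp only [blockThree, h2, Nat.cast_mul]
  simp only [step, sumNodes, h2, hc, hi, h1, h2', h3]

/-- The weight `f * l ^ k`, where `k` is the number of covered corners. -/
def geomWeight (f l : ℝ) (x y z : Bool) : ℝ :=
  f * (bif x then l else 1) * (bif y then l else 1) * (bif z then l else 1)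

/-- The weight is a product over corners, so the sum factors over nodes. A node in two copies gives
`1 + 2 * l`, one in three copies gives `1 + 3 * l`, and an uncovered outer corner gives 1. -/
theorem step_geomWeight (f l : ℝ) :
    step (geomWeight f l) false false false = f ^ 10 * (1 + 2 * l) ^ 9 * (1 + 3 * l) ^ 3 := by
  have h1 : ∀ m m', sumInner (blockOne (geomWeight f l) (geomWeight f l false) m m') = fun k =>
      f ^ 3 * (1 + 2 * l) ^ 2 * (bif m then l else 1) * (bif m' then l else 1) *
        (bif k then 1 else 1 + 2 * l) := by
    intro m m'
    funext k
    cases k <;> simp only [sumInner, blockOne, sumTwo, geomWeight, cond_true, cond_false] <;> ring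
  have h2 : ∀ m m', sumInner (blockTwo (geomWeight f l) (fun u v => geomWeight f l u false v) m m')
      = fun k => f ^ 3 * (1 + 2 * l) ^ 2 * (bif m then l else 1) * (bif m' then l else 1) *
        (bif k then 1 else 1 + 2 * l) := by
    intro m m'
    funext k
    cases k <;> simp only [sumInner, blockTwo, sumTwo, geomWeight, cond_true, cond_false] <;> ring
  have h3 : ∀ m m', sumInner (blockThree (geomWeight f l) (fun u v => geomWeight f l u v false) m m')
      = fun k => f ^ 3 * (1 + 2 * l) ^ 2 * (bif m then l else 1) * (bif m' then l else 1) *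
        (bif k then 1 else 1 + 2 * l) := by
    intro m m'
    funext k
    cases k <;> simp only [sumInner, blockThree, sumTwo, geomWeight, cond_true, cond_false] <;> ring
  -- An inner node contributes `l` if the central copy covers it and `1 + 2 * l` otherwise, in total
  -- `1 + 3 * l`.
  have hc : ∀ a b c : ℝ, sumCenter (geomWeight f l) (fun k => a * bif k then 1 else 1 + 2 * l)
      (fun k => b * bif k then 1 else 1 + 2 * l) (fun k => c * bif k then 1 else 1 + 2 * l) =
      f * (1 + 3 * l) ^ 3 * (a * b * c) := by
    intro a b c
    simp only [sumCenter, geomWeight, cond_true, cond_false]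
    ring
  have hm : ∀ a : ℝ, (sumTwo fun m₁ m₁' => sumTwo fun m₂ m₂' => sumTwo fun m₃ m₃' =>
      a * (bif m₁ then l else 1) * (bif m₁' then l else 1) * (bif m₂ then l else 1) *
        (bif m₂' then l else 1) * (bif m₃ then l else 1) * (bif m₃' then l else 1)) =
      a * (1 + 2 * l) ^ 3 := by
    intro a
    simp only [sumTwo, cond_true, cond_false]
    ring
  rw [step, sumNodes]
  simp only [h1, h2, h3, hc]
  -- Six factors `1 + 2 * l` come from the nodes inside the blocks, the other three from the
  -- midpoints.
  rw [show f ^ 10 * (1 + 2 * l) ^ 9 * (1 + 3 * l) ^ 3 =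
    (f ^ 10 * (1 + 2 * l) ^ 6 * (1 + 3 * l) ^ 3) * (1 + 2 * l) ^ 3 by ring, ← hm]
  refine congrArg sumTwo <| funext₂ fun _ _ => congrArg sumTwo <| funext₂ fun _ _ =>
    congrArg sumTwo <| funext₂ fun _ _ => ?_
  ring

/-- All ratios between the weights with a given corner covered and not covered lie between `l`
and `u`. -/
structure RatioBounds (l u : ℝ) (w : Bool → Bool → Bool → ℝ) : Prop where
  nonneg : ∀ x y z, 0 ≤ w x y z
  lower_one : ∀ y z, l * w false y z ≤ w true y z
  upper_one : ∀ y z, w true y z ≤ u * w false y z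
  lower_two : ∀ x z, l * w x false z ≤ w x true z
  upper_two : ∀ x z, w x true z ≤ u * w x false z
  lower_three : ∀ x y, l * w x y false ≤ w x y true
  upper_three : ∀ x y, w x y true ≤ u * w x y false

/-- Covering an outer corner changes the weights of one copy only. There the old ratio bound applies
termwise, and the scalar `l` or `u` comes out by linearity. -/
theorem RatioBounds.step {l u : ℝ} (hl : 0 ≤ l) {w : Bool → Bool → Bool → ℝ}
    (h : RatioBounds l u w) : RatioBounds l u (step w) where
  nonneg x y z := by
    -- Nonnegativity is monotonicity against zero weights.
    have := sumNodes_mono (w := fun _ _ _ => 0) (p₁ := fun _ _ => 0) (p₂ := fun _ _ => 0)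
      (p₃ := fun _ _ => 0) (fun _ _ _ => le_rfl) h.nonneg (fun _ _ => le_rfl)
      (fun u v => h.nonneg x u v) (fun _ _ => le_rfl) (fun u v => h.nonneg u y v)
      (fun _ _ => le_rfl) (fun u v => h.nonneg u v z)
    refine le_trans (le_of_eq ?_) this
    simp [sumNodes, sumCenter, sumTwo]
  lower_one y z := by
    rw [SierpinskiGasket.step, ← sumNodes_mul_one]
    exact sumNodes_mono h.nonneg (fun _ _ _ => le_rfl) (fun _ _ => mul_nonneg hl (h.nonneg _ _ _))
      (fun _ _ => h.lower_one _ _) (fun _ _ => h.nonneg _ _ _) (fun _ _ => le_rfl)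
      (fun _ _ => h.nonneg _ _ _) (fun _ _ => le_rfl)
  upper_one y z := by
    rw [SierpinskiGasket.step, SierpinskiGasket.step, ← sumNodes_mul_one]
    exact sumNodes_mono h.nonneg (fun _ _ _ => le_rfl) (fun _ _ => h.nonneg _ _ _)
      (fun _ _ => h.upper_one _ _) (fun _ _ => h.nonneg _ _ _) (fun _ _ => le_rfl)
      (fun _ _ => h.nonneg _ _ _) (fun _ _ => le_rfl)
  lower_two x z := by
    rw [SierpinskiGasket.step, ← sumNodes_mul_two]
    exact sumNodes_mono h.nonneg (fun _ _ _ => le_rfl) (fun _ _ => h.nonneg _ _ _)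
      (fun _ _ => le_rfl) (fun _ _ => mul_nonneg hl (h.nonneg _ _ _))
      (fun _ _ => h.lower_two _ _) (fun _ _ => h.nonneg _ _ _) (fun _ _ => le_rfl)
  upper_two x z := by
    rw [SierpinskiGasket.step, SierpinskiGasket.step, ← sumNodes_mul_two]
    exact sumNodes_mono h.nonneg (fun _ _ _ => le_rfl) (fun _ _ => h.nonneg _ _ _)
      (fun _ _ => le_rfl) (fun _ _ => h.nonneg _ _ _) (fun _ _ => h.upper_two _ _)
      (fun _ _ => h.nonneg _ _ _) (fun _ _ => le_rfl)
  lower_three x y := by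
    rw [SierpinskiGasket.step, ← sumNodes_mul_three]
    exact sumNodes_mono h.nonneg (fun _ _ _ => le_rfl) (fun _ _ => h.nonneg _ _ _)
      (fun _ _ => le_rfl) (fun _ _ => h.nonneg _ _ _) (fun _ _ => le_rfl)
      (fun _ _ => mul_nonneg hl (h.nonneg _ _ _)) (fun _ _ => h.lower_three _ _)
  upper_three x y := by
    rw [SierpinskiGasket.step, SierpinskiGasket.step, ← sumNodes_mul_three]
    exact sumNodes_mono h.nonneg (fun _ _ _ => le_rfl) (fun _ _ => h.nonneg _ _ _)
      (fun _ _ => le_rfl) (fun _ _ => h.nonneg _ _ _) (fun _ _ => le_rfl)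
      (fun _ _ => h.nonneg _ _ _) (fun _ _ => h.upper_three _ _)

/-- The corners are switched on one at a time, each at the cost of one ratio. -/
theorem RatioBounds.geomWeight_le {l u : ℝ} (hl : 0 ≤ l) {w : Bool → Bool → Bool → ℝ}
    (h : RatioBounds l u w) (x y z : Bool) :
    geomWeight (w false false false) l x y z ≤ w x y z := by
  have h1 : (bif x then l else 1) * w false false false ≤ w x false false := by
    cases x
    · simp
    · exact h.lower_one _ _
  have h2 : (bif y then l else 1) * w x false false ≤ w x y false := by
    cases y
    · simp
    · exact h.lower_two _ _
  have h3 : (bif z then l else 1) * w x y false ≤ w x y z := by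
    cases z
    · simp
    · exact h.lower_three _ _
  have hb : ∀ b : Bool, 0 ≤ bif b then l else 1 := by
    intro b; cases b <;> simp [hl]
  refine le_trans (le_trans (le_of_eq ?_)
    (mul_le_mul_of_nonneg_left (mul_le_mul_of_nonneg_left h1 (hb y)) (hb z)))
    ((mul_le_mul_of_nonneg_left h2 (hb z)).trans h3)
  rw [geomWeight]
  ring

theorem RatioBounds.le_geomWeight {l u : ℝ} (hu : 0 ≤ u) {w : Bool → Bool → Bool → ℝ}
    (h : RatioBounds l u w) (x y z : Bool) :
    w x y z ≤ geomWeight (w false false false) u x y z := by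
  have h1 : w x false false ≤ (bif x then u else 1) * w false false false := by
    cases x
    · simp
    · exact h.upper_one _ _
  have h2 : w x y false ≤ (bif y then u else 1) * w x false false := by
    cases y
    · simp
    · exact h.upper_two _ _
  have h3 : w x y z ≤ (bif z then u else 1) * w x y false := by
    cases z
    · simp
    · exact h.upper_three _ _
  have hb : ∀ b : Bool, 0 ≤ bif b then u else 1 := by
    intro b; cases b <;> simp [hu]
  refine (h3.trans (mul_le_mul_of_nonneg_left h2 (hb z))).trans ((mul_le_mul_of_nonneg_left
    (mul_le_mul_of_nonneg_left h1 (hb y)) (hb z)).trans (le_of_eq ?_))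
  rw [geomWeight]
  ring

theorem step_mono {w w' : Bool → Bool → Bool → ℝ} (hw₀ : ∀ x y z, 0 ≤ w x y z)
    (hw : ∀ x y z, w x y z ≤ w' x y z) (x y z : Bool) : step w x y z ≤ step w' x y z :=
  sumNodes_mono hw₀ hw (fun _ _ => hw₀ _ _ _) (fun _ _ => hw _ _ _) (fun _ _ => hw₀ _ _ _)
    (fun _ _ => hw _ _ _) (fun _ _ => hw₀ _ _ _) (fun _ _ => hw _ _ _)

theorem geomWeight_nonneg {f l : ℝ} (hf : 0 ≤ f) (hl : 0 ≤ l) (x y z : Bool) :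
    0 ≤ geomWeight f l x y z := by
  have hb : ∀ b : Bool, 0 ≤ bif b then l else 1 := by
    intro b; cases b <;> simp [hl]
  exact mul_nonneg (mul_nonneg (mul_nonneg hf (hb x)) (hb y)) (hb z)

theorem RatioBounds.le_step {l u : ℝ} (hl : 0 ≤ l) {w : Bool → Bool → Bool → ℝ}
    (h : RatioBounds l u w) :
    w false false false ^ 10 * (1 + 2 * l) ^ 9 * (1 + 3 * l) ^ 3 ≤
      SierpinskiGasket.step w false false false := by
  rw [← step_geomWeight]
  exact step_mono (geomWeight_nonneg (h.nonneg _ _ _) hl) (h.geomWeight_le hl) _ _ _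

theorem RatioBounds.step_le {l u : ℝ} (hu : 0 ≤ u) {w : Bool → Bool → Bool → ℝ}
    (h : RatioBounds l u w) :
    SierpinskiGasket.step w false false false ≤
      w false false false ^ 10 * (1 + 2 * u) ^ 9 * (1 + 3 * u) ^ 3 := by
  rw [← step_geomWeight]
  exact step_mono h.nonneg (h.le_geomWeight hu) _ _ _

end Bounds

/-! ### Existence of the growth constant and bounds from stage 2 -/

section Limit

/-- A sequence that grows by the factor `b` up to bounded errors has a growth constant, which can be
estimated from any term of the sequence. -/
theorem exists_tendsto_div_pow {b A B : ℝ} (hb : 1 < b) {a : ℕ → ℝ} {m : ℕ}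
    (hA : ∀ n, m ≤ n → b * a n + A ≤ a (n + 1)) (hB : ∀ n, m ≤ n → a (n + 1) ≤ b * a n + B) :
    ∃ L, Tendsto (fun n => a n / b ^ n) atTop (𝓝 L) ∧
      (a m + A / (b - 1)) / b ^ m ≤ L ∧ L ≤ (a m + B / (b - 1)) / b ^ m := by
  have hb0 : 0 < b := by linarith
  have hb1 : 0 < b - 1 := by linarith
  have hpow : ∀ n, 0 < b ^ n := fun n => pow_pos hb0 n
  have hAB : A / (b - 1) ≤ B / (b - 1) :=
    div_le_div_of_nonneg_right (by linarith [hA m le_rfl, hB m le_rfl]) hb1.le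
  -- Adding `A / (b - 1)` turns `x ↦ b * x + A` into multiplication by `b`. So `s` increases, and
  -- likewise `t` decreases.
  let s : ℕ → ℝ := fun n => (a (n + m) + A / (b - 1)) / b ^ (n + m)
  let t : ℕ → ℝ := fun n => (a (n + m) + B / (b - 1)) / b ^ (n + m)
  have hs : Monotone s := by
    refine monotone_nat_of_le_succ fun n => ?_
    have h := hA (n + m) (Nat.le_add_left _ _)
    have e : A / (b - 1) * b = A / (b - 1) + A := by field_simp; ring
    simp only [s]
    rw [Nat.add_right_comm, pow_succ, div_le_div_iff₀ (hpow _) (mul_pos (hpow _) hb0)]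
    have : (a (n + m) + A / (b - 1)) * b ≤ a (n + m + 1) + A / (b - 1) := by linarith
    nlinarith [mul_le_mul_of_nonneg_right this (hpow (n + m)).le]
  have ht : Antitone t := by
    refine antitone_nat_of_succ_le fun n => ?_
    have h := hB (n + m) (Nat.le_add_left _ _)
    have e : B / (b - 1) * b = B / (b - 1) + B := by field_simp; ring
    simp only [t]
    rw [Nat.add_right_comm, pow_succ, div_le_div_iff₀ (mul_pos (hpow _) hb0) (hpow _)]
    have : a (n + m + 1) + B / (b - 1) ≤ (a (n + m) + B / (b - 1)) * b := by linarith
    nlinarith [mul_le_mul_of_nonneg_right this (hpow (n + m)).le]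
  have hst : ∀ n, s n ≤ t 0 := fun n =>
    (div_le_div_of_nonneg_right (by linarith) (hpow _).le : s n ≤ t n).trans (ht (Nat.zero_le n))
  have hbdd : BddAbove (Set.range s) := ⟨t 0, by rintro _ ⟨n, rfl⟩; exact hst n⟩
  refine ⟨⨆ n, s n, ?_, ?_, ?_⟩
  · rw [← tendsto_add_atTop_iff_nat m]
    have h0 : Tendsto (fun n => A / (b - 1) / b ^ (n + m)) atTop (𝓝 0) :=
      ((tendsto_pow_atTop_atTop_of_one_lt hb).comp (tendsto_add_atTop_nat m)).const_div_atTop _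
    have h := (tendsto_atTop_ciSup hs hbdd).sub h0
    rw [sub_zero] at h
    refine h.congr fun n => ?_
    simp only [s, add_div]
    ring
  · have := le_ciSup hbdd 0
    simpa [s] using this
  · have := ciSup_le hst
    simpa [t] using this

/-- A rational lower bound for the ratios in `RatioBounds` at stage `2`. -/
noncomputable def ratioLower : ℝ := 8587664689398 / 10 ^ 13

/-- A rational upper bound for the ratios in `RatioBounds` at stage `2`. -/
noncomputable def ratioUpper : ℝ := 8587664689426 / 10 ^ 13

theorem ratioLower_pos : 0 < ratioLower := by norm_num [ratioLower]

theorem ratioUpper_pos : 0 < ratioUpper := by norm_num [ratioUpper]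

theorem ratioBounds_count {n : ℕ} (hn : 2 ≤ n) :
    RatioBounds ratioLower ratioUpper fun x y z => (count n x y z : ℝ) := by
  induction n, hn using Nat.le_induction with
  | base =>
    rw [count_two]
    constructor <;> first
      | exact fun _ _ _ => Nat.cast_nonneg _
      | (intro a b
         cases a <;> cases b <;> simp only [symm, cond_true, cond_false] <;>
           norm_num [ratioLower, ratioUpper])
  | succ n _ ih =>
    have : (fun x y z => (count (n + 1) x y z : ℝ)) = step fun x y z => (count n x y z : ℝ) := by
      funext x y z
      rw [count_succ, cast_step]
    rw [this]
    exact ih.step ratioLower_pos.le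

theorem le_count_succ {n : ℕ} (hn : 2 ≤ n) :
    (count n false false false : ℝ) ^ 10 * (1 + 2 * ratioLower) ^ 9 * (1 + 3 * ratioLower) ^ 3 ≤
      count (n + 1) false false false := by
  rw [count_succ, cast_step]
  exact (ratioBounds_count hn).le_step ratioLower_pos.le

theorem count_succ_le {n : ℕ} (hn : 2 ≤ n) : (count (n + 1) false false false : ℝ) ≤
    (count n false false false : ℝ) ^ 10 * (1 + 2 * ratioUpper) ^ 9 * (1 + 3 * ratioUpper) ^ 3 := by
  rw [count_succ, cast_step]
  exact (ratioBounds_count hn).step_le ratioUpper_pos.le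

theorem count_pos {n : ℕ} (hn : 2 ≤ n) : (0 : ℝ) < count n false false false := by
  have := ratioLower_pos
  induction n, hn using Nat.le_induction with
  | base => rw [count_two]; simp only [symm, cond_false]; norm_num
  | succ n hn ih => exact lt_of_lt_of_le (by positivity) (le_count_succ hn)

theorem log_pow_mul_pow_mul_pow {f l : ℝ} (hf : 0 < f) (hl : 0 < l) :
    Real.log (f ^ 10 * (1 + 2 * l) ^ 9 * (1 + 3 * l) ^ 3) =
      10 * Real.log f + (9 * Real.log (1 + 2 * l) + 3 * Real.log (1 + 3 * l)) := by
  rw [Real.log_mul (by positivity) (by positivity), Real.log_mul (by positivity) (by positivity),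
    Real.log_pow, Real.log_pow, Real.log_pow]
  push_cast
  ring

theorem count_le_matchings (n : ℕ) : count n false false false ≤ (matchings (edges n)).card :=
  Finset.card_filter_le _ _

/-- There are eight coverage patterns of the corners; as `ratioUpper < 1`, the pattern with no
covered corner has the largest count. -/
theorem matchings_le_count {n : ℕ} (hn : 2 ≤ n) :
    (matchings (edges n)).card ≤ 8 * count n false false false := by
  have hle : ∀ x y z, count n x y z ≤ count n false false false := by
    intro x y z
    have h := (ratioBounds_count hn).le_geomWeight ratioUpper_pos.le x y z
    have hb : ∀ b : Bool, 0 ≤ (bif b then ratioUpper else 1) ∧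
        (bif b then ratioUpper else 1) ≤ 1 := by
      intro b; cases b <;> norm_num [ratioUpper]
    have hc := (count_pos hn).le
    have h1 : (count n x y z : ℝ) ≤ count n false false false := by
      refine h.trans ?_
      rw [geomWeight]
      exact (mul_le_of_le_one_right (mul_nonneg (mul_nonneg hc (hb x).1) (hb y).1) (hb z).2).trans
        ((mul_le_of_le_one_right (mul_nonneg hc (hb x).1) (hb y).2).trans
          (mul_le_of_le_one_right hc (hb x).2))
    exact_mod_cast h1
  rw [Finset.card_eq_sum_card_fiberwise
    (f := fun M => fun i : Fin 3 => decide (Covers M (4 ^ n • offset i)))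
    (t := Finset.univ) fun _ _ => Finset.mem_univ _]
  refine (Finset.sum_le_card_nsmul _ _ (count n false false false) fun s _ => ?_).trans
    (by simp)
  refine le_trans (le_of_eq ?_) (hle (s 0) (s 1) (s 2))
  rw [count]
  congr 1
  refine Finset.filter_congr fun M _ => ?_
  rw [show ![s 0, s 1, s 2] = s by ext i; fin_cases i <;> rfl, funext_iff]
  refine forall_congr' fun i => ?_
  cases s i <;> simp

/-- The estimates of the growth constant in terms of the numbers of stage `2`. -/
theorem exists_isGrowthConstant : ∃ z : ℝ, IsGrowthConstant (fun n => SG 4 n) z ∧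
    3 * Real.log (count 2 false false false) + 3 * Real.log (1 + 2 * ratioLower) +
      Real.log (1 + 3 * ratioLower) ≤ 400 * z ∧
    400 * z ≤ 3 * Real.log (count 2 false false false) + 3 * Real.log (1 + 2 * ratioUpper) +
      Real.log (1 + 3 * ratioUpper) := by
  obtain ⟨L, hL, hlo, hhi⟩ := exists_tendsto_div_pow (b := 10) (by norm_num)
    (a := fun n => Real.log (count n false false false)) (m := 2)
    (A := 9 * Real.log (1 + 2 * ratioLower) + 3 * Real.log (1 + 3 * ratioLower))
    (B := 9 * Real.log (1 + 2 * ratioUpper) + 3 * Real.log (1 + 3 * ratioUpper))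
    (fun n hn => by
      have h := ratioLower_pos
      have hc := count_pos hn
      rw [← log_pow_mul_pow_mul_pow hc h]
      exact Real.log_le_log (by positivity) (le_count_succ hn))
    (fun n hn => by
      rw [← log_pow_mul_pow_mul_pow (count_pos hn) ratioUpper_pos]
      exact Real.log_le_log (count_pos (by omega)) (count_succ_le hn))
  have hv : ∀ n, (Nat.card (gasket 4 n).verts : ℝ) = (4 * 10 ^ n + 5) / 3 := by
    intro n
    have h : ((3 * (verts n).card : ℕ) : ℝ) = ((4 * 10 ^ n + 5 : ℕ) : ℝ) :=
      congrArg _ (three_mul_card_verts n)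
    push_cast at h
    rw [natCard_verts]
    linarith
  have hN : ∀ n, dimerMonomerCount (SG 4 n) = (matchings (edges n)).card := fun n =>
    dimerMonomerCount_coe _ _ (adj_iff_mem_edges n)
  have hpow : Tendsto (fun n : ℕ => (10 : ℝ) ^ n) atTop atTop :=
    tendsto_pow_atTop_atTop_of_one_lt (by norm_num)
  have hlog : Tendsto (fun n => Real.log (dimerMonomerCount (SG 4 n)) / 10 ^ n) atTop (𝓝 L) := by
    -- All matchings number between one and eight times the count with uncovered corners, and `log 8
    -- / 10 ^ n` vanishes in the limit.
    have h8 := hL.add (hpow.const_div_atTop (Real.log 8))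
    rw [add_zero] at h8
    refine tendsto_of_tendsto_of_tendsto_of_le_of_le' hL h8 ?_ ?_
    · filter_upwards [eventually_ge_atTop 2] with n hn
      rw [hN]
      exact div_le_div_of_nonneg_right (Real.log_le_log (count_pos hn)
        (by exact_mod_cast count_le_matchings n)) (by positivity)
    · filter_upwards [eventually_ge_atTop 2] with n hn
      rw [hN, ← add_div]
      refine div_le_div_of_nonneg_right ?_ (by positivity)
      rw [add_comm, ← Real.log_mul (by norm_num) (count_pos hn).ne']
      refine Real.log_le_log ((count_pos hn).trans_le (by exact_mod_cast count_le_matchings n)) ?_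
      exact_mod_cast matchings_le_count hn
  -- The number of vertices is asymptotic to `(4 / 3) * 10 ^ n`. With `m = 2` and `b - 1 = 9`,
  -- multiplying by 400 clears the denominators of the bounds.
  refine ⟨3 / 4 * L, ⟨?_, ?_⟩, ?_, ?_⟩
  · rw [← tendsto_natCast_atTop_iff (R := ℝ)]
    simp only [hv]
    exact ((hpow.const_mul_atTop (by norm_num : (0 : ℝ) < 4)).atTop_add
      (tendsto_const_nhds (x := (5 : ℝ)))).atTop_div_const (by norm_num)
  · have hq : Tendsto (fun n : ℕ => (4 + 5 / (10 : ℝ) ^ n) / 3) atTop (𝓝 (4 / 3)) := by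
      simpa using ((hpow.const_div_atTop 5).const_add 4).div_const 3
    have h := hlog.div hq (by norm_num)
    rw [show 3 / 4 * L = L / (4 / 3) by ring]
    refine h.congr fun n => ?_
    rw [Pi.div_apply, hv]
    have : (10 : ℝ) ^ n ≠ 0 := by positivity
    field_simp
  · linarith
  · linarith

end Limit

/-! ### Comparison of exponentials by exact rational arithmetic -/

section Numerics

/-- Exponentiating removes the logarithms: with a rational bound `r` for `exp z`, only a comparison
with `r ^ 400` remains. -/
theorem le_three_mul_log {f l r z : ℝ} (hf : 0 < f) (hl : 0 < l) (hz : Real.exp z ≤ r)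
    (h : r ^ 400 ≤ f ^ 3 * (1 + 2 * l) ^ 3 * (1 + 3 * l)) :
    400 * z ≤ 3 * Real.log f + 3 * Real.log (1 + 2 * l) + Real.log (1 + 3 * l) := by
  have h1 : Real.exp (400 * z) ≤ f ^ 3 * (1 + 2 * l) ^ 3 * (1 + 3 * l) := by
    rw [mul_comm (400 : ℝ), Real.exp_mul]
    exact le_trans (by exact_mod_cast pow_le_pow_left₀ (Real.exp_pos z).le hz 400) h
  have h2 := (Real.le_log_iff_exp_le (by positivity)).2 h1
  rw [Real.log_mul (by positivity) (by positivity), Real.log_mul (by positivity) (by positivity),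
    Real.log_pow, Real.log_pow] at h2
  exact_mod_cast h2

theorem three_mul_log_lt {f l r z : ℝ} (hf : 0 < f) (hl : 0 < l) (hr : 0 ≤ r)
    (hz : r ≤ Real.exp z) (h : f ^ 3 * (1 + 2 * l) ^ 3 * (1 + 3 * l) < r ^ 400) :
    3 * Real.log f + 3 * Real.log (1 + 2 * l) + Real.log (1 + 3 * l) < 400 * z := by
  have h1 : f ^ 3 * (1 + 2 * l) ^ 3 * (1 + 3 * l) < Real.exp (400 * z) := by
    rw [mul_comm (400 : ℝ), Real.exp_mul]
    exact lt_of_lt_of_le h (by exact_mod_cast pow_le_pow_left₀ hr hz 400)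
  have h2 := (Real.log_lt_iff_lt_exp (by positivity)).2 h1
  rw [Real.log_mul (by positivity) (by positivity), Real.log_mul (by positivity) (by positivity),
    Real.log_pow, Real.log_pow] at h2
  exact_mod_cast h2

/-- Sixteen Taylor terms with the remainder estimate suffice; in `le_exp` the partial sum alone is a
lower bound. -/
theorem exp_le : Real.exp 0.684872262332 ≤ 1.9835184493328705 := by
  refine (Real.exp_bound' (by norm_num) (by norm_num) (n := 16) (by norm_num)).trans ?_
  norm_num [Finset.sum_range_succ, Nat.factorial]

theorem le_exp : 1.9835184493348537 ≤ Real.exp 0.684872262333 := by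
  refine le_trans ?_ (Real.sum_le_exp_of_nonneg (by norm_num) 16)
  norm_num [Finset.sum_range_succ, Nat.factorial]

set_option exponentiation.threshold 10000 in
theorem pow_le_count_two : (1.9835184493328705 : ℝ) ^ 400 ≤
    (count 2 false false false : ℝ) ^ 3 * (1 + 2 * ratioLower) ^ 3 * (1 + 3 * ratioLower) := by
  rw [count_two]
  simp only [symm, cond_false, ratioLower]
  norm_num

set_option exponentiation.threshold 10000 in
theorem count_two_lt_pow :
    (count 2 false false false : ℝ) ^ 3 * (1 + 2 * ratioUpper) ^ 3 * (1 + 3 * ratioUpper) <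
      (1.9835184493348537 : ℝ) ^ 400 := by
  rw [count_two]
  simp only [symm, cond_false, ratioUpper]
  norm_num

end Numerics

end SierpinskiGasket

theorem mainTheorem9 :
    ∃ z : ℝ, SierpinskiGasket.IsGrowthConstant (fun n => SierpinskiGasket.SG 4 n) z ∧
      (0.684872262332 : ℝ) ≤ z ∧ z < (0.684872262333 : ℝ) := by
  obtain ⟨z, hz, hlo, hhi⟩ := SierpinskiGasket.exists_isGrowthConstant
  have hc := SierpinskiGasket.count_pos le_rfl
  have h1 := SierpinskiGasket.le_three_mul_log hc SierpinskiGasket.ratioLower_pos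
    SierpinskiGasket.exp_le SierpinskiGasket.pow_le_count_two
  have h2 := SierpinskiGasket.three_mul_log_lt hc SierpinskiGasket.ratioUpper_pos (by norm_num)
    SierpinskiGasket.le_exp SierpinskiGasket.count_two_lt_pow
  exact ⟨z, hz, by linarith, by linarith⟩
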